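/- **Setting.** Let $(\mathscr A,\varphi)$ be a tracial $W^*$-probability space ($\mathscr A$ a von Neumann algebra, $\varphi$ a weakly continuous (normal), unital, positive, faithful, tracial linear functional), and let $S=(S_t)_{t\ge 0}$ be a free Brownian motion in $\mathscr A$ with respect to a filtration $(\mathscr A_t)_{t\ge0}$ of von Neumann subalgebras: each $S_t\in\mathscr A_t$ is self-adjoint, $S_0=0$, $S_t$ has the centered semicircular law of variance $t$ for $t>0$, and for $0\le u<t$ the increment $S_t-S_u$ is free from $\mathscr A_u$ and has the centered semicircular law of variance $t-u$. Let $L^2(\mathscr A,\varphi)$ be the completion of $\mathscr A$ for $\|X\|_2=\varphi(XX^*)^{1/2}$ and $L^2(\mathscr A\otimes\mathscr A,\varphi\otimes\varphi)=L^2(\mathscr A,\varphi)\otimes L^2(\mathscr A,\varphi)$ (Hilbert space tensor product). For $n\ge 0$ the Wigner integral $I_n:L^2(\mathbb R_+^n)\to L^2(\mathscr A,\varphi)$ (complex-valued functions, Lebesgue measure) is the continuous linear extension of $$I_n\big(\mathbf 1_{[a_1,b_1)\times\cdots\times[a_n,b_n)}\big)=(S_{b_1}-S_{a_1})\cdots(S_{b_n}-S_{a_n}),\qquad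 [a_i,b_i)\ \text{pairwise disjoint},$$ so that $I_0(c)=c\cdot 1$. The Wigner bi-integral $I_n\otimes I_m: L^2(\mathbb R_+^n)\otimes L^2(\mathbb R_+^m)\cong L^2(\mathbb R_+^{n}\times\mathbb R_+^m)\to L^2(\mathscr A\otimes\mathscr A,\varphi\otimes\varphi)$ is the continuous linear extension of $g\otimes h\mapsto I_n(g)\otimes I_m(h)$. The product $\sharp$ is the bilinear map on $\mathscr A\otimes\mathscr A$ with $(A\otimes B)\sharp(C\otimes D)=(AC)\otimes(DB)$. For $U,V,W\in L^2(\mathscr A\otimes\mathscr A,\varphi\otimes\varphi)$ one writes $U\sharp V=W$ if there are $x_k,y_k\in\mathscr A\otimes\mathscr A$ with $x_k\to U$, $y_k\to V$ and $x_k\sharp y_k\to W$ in $L^2(\mathscr A\otimes\mathscr A,\varphi\otimes\varphi)$. Let $n_1,m_1,n_2,m_2$ be nonnegative integers, $f\in L^2(\mathbb R_+^{n_1})\otimes L^2(\mathbb R_+^{m_1})$, $g\in L^2(\mathbb R_+^{n_2})\otimes L^2(\mathbb R_+^{m_2})$. For $0\le p\le n_1\wedge n_2$ and $0\le r\le m_1\wedge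 m_2$, the $(p,r)$-bicontraction $f\frown_{p,r}g\in L^2(\mathbb R_+^{n_1+n_2-2p})\otimes L^2(\mathbb R_+^{m_1+m_2-2r})$ is $$\begin{aligned}(f\frown_{p,r} g)(t,u)=\int_{\mathbb R_+^{p}\times\mathbb R_+^{r}} &f(t_1,\dots,t_{n_1-p},s_p,\dots,s_1;\ y_1,\dots,y_r,u_{m_2-r+1},\dots,u_{m_1+m_2-2r})\\ &\times g(s_1,\dots,s_p,t_{n_1-p+1},\dots,t_{n_1+n_2-2p};\ u_1,\dots,u_{m_2-r},y_r,\dots,y_1)\,ds\,dy.\end{aligned}$$ **Theorem (biproduct formula).** For all such $n_1,m_1,n_2,m_2,f,g$, the product of $I_{n_1}\otimes I_{m_1}(f)$ and $I_{n_2}\otimes I_{m_2}(g)$ exists, is unique, and $$I_{n_1}\otimes I_{m_1}(f)\ \sharp\ I_{n_2}\otimes I_{m_2}(g)=\sum_{p=0}^{n_1\wedge n_2}\ \sum_{r=0}^{m_1\wedge m_2} I_{n_1+n_2-2p}\otimes I_{m_1+m_2-2r}\big(f\frown_{p,r}g\big).$$ -/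

import Mathlib

open MeasureTheory UniformSpace
open scoped NNReal ComplexOrder TensorProduct

noncomputable section

namespace WignerSpace

universe u

/-! ### Tracial `W*`-probability spaces -/

section WStar

/-- A Banach space predual of a `W*`-algebra. -/
structure Predual (A : Type u) [CStarAlgebra A] where
  X : Type u
  [normed : NormedAddCommGroup X]
  [space : NormedSpace ℂ X]
  [complete : CompleteSpace X]
  equiv : StrongDual ℂ X ≃ₗᵢ⋆[ℂ] A

attribute [instance] Predual.normed Predual.space Predual.complete

theorem nonempty_predual (A : Type u) [CStarAlgebra A] [WStarAlgebra A] :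
    Nonempty (Predual A) := by
  obtain ⟨X, i₁, i₂, i₃, ⟨e⟩⟩ := WStarAlgebra.exists_predual (M := A)
  exact ⟨⟨X, e⟩⟩

/-- The ultraweak (weak-`*`) topology of a von Neumann algebra, transported from the weak-`*`
topology on the dual of its predual (the predual is unique, so the choice does not matter). -/
abbrev ultraweak (A : Type u) [CStarAlgebra A] [WStarAlgebra A] : TopologicalSpace A :=
  let P : Predual A := (nonempty_predual A).some
  TopologicalSpace.coinduced
    (fun ξ : WeakDual ℂ P.X => P.equiv (WeakDual.toStrongDual ξ)) inferInstance

variable {A : Type u} [CStarAlgebra A] [WStarAlgebra A] [PartialOrder A] [StarOrderedRing A]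

/-- `(A, φ)` is a tracial `W*`-probability space: the positive linear functional `φ` on the
von Neumann algebra `A` is unital, weakly continuous (normal), faithful and tracial. -/
structure IsTracialState (φ : A →ₚ[ℂ] ℂ) : Prop where
  unital : φ 1 = 1
  normal : @Continuous A ℂ (ultraweak A) inferInstance φ
  faithful : ∀ x, φ (x * star x) = 0 → x = 0
  tracial : ∀ x y, φ (x * y) = φ (y * x)

/-- Free independence of a family of unital subalgebras: `φ` vanishes on every nonempty product of
centered elements whose consecutive factors come from different members of the family. -/
def Free {ι : Type*} (φ : A →ₚ[ℂ] ℂ) (B : ι → Subalgebra ℂ A) : Prop :=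
  ∀ (n : ℕ) (i : Fin (n + 1) → ι) (x : Fin (n + 1) → A),
    (∀ k, x k ∈ B (i k)) → (∀ k, φ (x k) = 0) →
    (∀ k : Fin n, i k.castSucc ≠ i k.succ) → φ (List.ofFn x).prod = 0

/-- The centered semicircular distribution of variance `t > 0`: density
`(2πt)⁻¹ √(4t - x²)` on `|x| < 2√t` (the real square root vanishes elsewhere). -/
def semicircular (t : ℝ) : Measure ℝ :=
  volume.withDensity fun x => ENNReal.ofReal ((2 * Real.pi * t)⁻¹ * √(4 * t - x ^ 2))

/-- The law of the self-adjoint element `x` is `μ`, i.e. `x` and `μ` have the same moments. -/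
def HasLaw (φ : A →ₚ[ℂ] ℂ) (x : A) (μ : Measure ℝ) : Prop :=
  ∀ k : ℕ, φ (x ^ k) = ((∫ y, y ^ k ∂μ : ℝ) : ℂ)

/-- `S` is a free Brownian motion with respect to the filtration `F` of von Neumann
subalgebras of `A`. -/
structure IsFreeBrownianMotion (φ : A →ₚ[ℂ] ℂ) (F : ℝ≥0 → StarSubalgebra ℂ A) (S : ℝ≥0 → A) :
    Prop where
  isClosed : ∀ t, @IsClosed A (ultraweak A) (F t : Set A)
  mono : Monotone F
  selfAdjoint : ∀ t, IsSelfAdjoint (S t)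
  zero : S 0 = 0
  adapted : ∀ t, S t ∈ F t
  law : ∀ t, 0 < t → HasLaw φ (S t) (semicircular t)
  free : ∀ u t, u < t →
    Free φ ![Algebra.adjoin ℂ {S t - S u}, (F u).toSubalgebra]
  law_increment : ∀ u t, u < t → HasLaw φ (S t - S u) (semicircular ((t : ℝ) - u))

end WStar

/-! ### The spaces `L²(ℝ₊ⁿ)` and `L²(ℝ₊ⁿ) ⊗ L²(ℝ₊ᵐ) ≅ L²(ℝ₊ⁿ × ℝ₊ᵐ)` -/

/-- Lebesgue measure on `ℝ₊ⁿ`, as a measure on `ℝⁿ` carried by the nonnegative orthant. -/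
abbrev leb (n : ℕ) : Measure (Fin n → ℝ) :=
  Measure.pi fun _ => (volume : Measure ℝ).restrict (Set.Ici 0)

/-- `L²(ℝ₊ⁿ)`, complex valued. -/
abbrev L2 (n : ℕ) : Type := Lp ℂ 2 (leb n)

/-- The Hilbert space tensor product `L²(ℝ₊ⁿ) ⊗ L²(ℝ₊ᵐ)`, realized as `L²(ℝ₊ⁿ × ℝ₊ᵐ)`. -/
abbrev L2Tensor (n m : ℕ) : Type := Lp ℂ 2 ((leb n).prod (leb m))

theorem memLp_tensor {n m : ℕ} (g : L2 n) (h : L2 m) :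
    MemLp (fun z : (Fin n → ℝ) × (Fin m → ℝ) => g z.1 * h z.2) 2 ((leb n).prod (leb m)) := by
  have hg := Lp.memLp g
  have hh := Lp.memLp h
  have hm : AEStronglyMeasurable (fun z : (Fin n → ℝ) × (Fin m → ℝ) => g z.1 * h z.2)
      ((leb n).prod (leb m)) := hg.1.comp_fst.mul hh.1.comp_snd
  rw [memLp_two_iff_integrable_sq_norm hm]
  have h₁ := (memLp_two_iff_integrable_sq_norm hg.1).1 hg
  have h₂ := (memLp_two_iff_integrable_sq_norm hh.1).1 hh
  simpa [mul_pow] using h₁.mul_prod h₂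

/-- The elementary tensor `g ⊗ h`, i.e. the function `(x, y) ↦ g x * h y`. -/
def tensorL2 {n m : ℕ} (g : L2 n) (h : L2 m) : L2Tensor n m :=
  (memLp_tensor g h).toLp _

/-! ### Multiple Wigner integrals -/

/-- A bounded box `[lo₁, hi₁) × ⋯ × [loₙ, hiₙ)` in `ℝ₊ⁿ` that does not meet any of the diagonals
`{tᵢ = tⱼ}`, `i ≠ j`. -/
structure Box (n : ℕ) where
  lo : Fin n → ℝ≥0
  hi : Fin n → ℝ≥0
  le : ∀ i, lo i ≤ hi i
  disjoint : ∀ i j, i ≠ j → Disjoint (Set.Ico (lo i) (hi i)) (Set.Ico (lo j) (hi j))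

namespace Box

variable {n : ℕ} (b : Box n)

def toSet : Set (Fin n → ℝ) := Set.univ.pi fun i => Set.Ico (b.lo i : ℝ) (b.hi i)

theorem measurableSet : MeasurableSet b.toSet :=
  MeasurableSet.univ_pi fun _ => measurableSet_Ico

theorem measure_ne_top : leb n b.toSet ≠ ⊤ := by
  rw [toSet, Measure.pi_pi]
  exact ENNReal.prod_ne_top fun i _ =>
    ((Measure.restrict_apply_le _ _).trans_lt (by simp)).ne

/-- The indicator function of the box. -/
def indicator : L2 n := indicatorConstLp 2 b.measurableSet b.measure_ne_top 1

end Box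

variable {A : Type u} [CStarAlgebra A] [PartialOrder A] [StarOrderedRing A]

/-- The canonical map `A → L²(A, φ)`; here `L²(A, φ) = φ.GNS` is the completion of `A` for the norm
`‖x‖₂ = φ(x* x) ^ (1 / 2)`, which is `φ(x x*) ^ (1 / 2)` when `φ` is tracial. -/
def toL2 (φ : A →ₚ[ℂ] ℂ) : A →ₗ[ℂ] φ.GNS :=
  (Completion.toComplL (𝕜 := ℂ) (E := φ.PreGNS)).toLinearMap ∘ₗ φ.toPreGNS.toLinearMap

/-- The integral of the indicator of a box: `(S hi₁ - S lo₁) ⋯ (S hiₙ - S loₙ)`. -/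
def increments (S : ℝ≥0 → A) {n : ℕ} (b : Box n) : A :=
  (List.ofFn fun i => S (b.hi i) - S (b.lo i)).prod

/-- The multiple Wigner integral `Iₙ : L²(ℝ₊ⁿ) → L²(A, φ)`: the continuous linear extension of
`𝟙_b ↦ (S hi₁ - S lo₁) ⋯ (S hiₙ - S loₙ)` from the indicators of off-diagonal boxes `b`, whose linear
span is dense. -/
def wignerIntegral (φ : A →ₚ[ℂ] ℂ) (S : ℝ≥0 → A) (n : ℕ) : L2 n →L[ℂ] φ.GNS :=
  (Finsupp.linearCombination ℂ fun b : Box n => toL2 φ (increments S b)).extendOfNorm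
    (Finsupp.linearCombination ℂ fun b : Box n => b.indicator)

/-! ### Wigner bi-integrals -/

/-- `L²(A ⊗ A, φ ⊗ φ)`, the Hilbert space tensor product of `L²(A, φ)` with itself, in which
`⟪a ⊗ b, c ⊗ d⟫ = φ(a* c) φ(b* d) = (φ ⊗ φ)((a ⊗ b)* (c ⊗ d))`. -/
abbrev BiL2 (φ : A →ₚ[ℂ] ℂ) : Type u := Completion (φ.GNS ⊗[ℂ] φ.GNS)

/-- The bi-integral `Iₙ ⊗ Iₘ : L²(ℝ₊ⁿ) ⊗ L²(ℝ₊ᵐ) → L²(A ⊗ A, φ ⊗ φ)`: the continuous linear extension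
of `g ⊗ h ↦ Iₙ(g) ⊗ Iₘ(h)`. -/
def biIntegral (φ : A →ₚ[ℂ] ℂ) (S : ℝ≥0 → A) (n m : ℕ) : L2Tensor n m →L[ℂ] BiL2 φ :=
  (Finsupp.linearCombination ℂ fun z : L2 n × L2 m =>
      ((wignerIntegral φ S n z.1 ⊗ₜ[ℂ] wignerIntegral φ S m z.2 : φ.GNS ⊗[ℂ] φ.GNS) :
        BiL2 φ)).extendOfNorm
    (Finsupp.linearCombination ℂ fun z : L2 n × L2 m => tensorL2 z.1 z.2)

/-! ### The product `♯` -/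

/-- The bilinear product `(a ⊗ b) ♯ (c ⊗ d) = (a c) ⊗ (d b)` on the algebraic tensor product. -/
def sharp : A ⊗[ℂ] A →ₗ[ℂ] A ⊗[ℂ] A →ₗ[ℂ] A ⊗[ℂ] A :=
  TensorProduct.map₂ (LinearMap.mul ℂ A) (LinearMap.mul ℂ A).flip

theorem sharp_tmul {B : Type u} [CStarAlgebra B] (a b c d : B) :
    sharp (a ⊗ₜ[ℂ] b) (c ⊗ₜ[ℂ] d) = (a * c) ⊗ₜ[ℂ] (d * b) := rfl

/-- The canonical map `A ⊗ A → L²(A ⊗ A, φ ⊗ φ)`. -/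
def toBiL2 (φ : A →ₚ[ℂ] ℂ) (x : A ⊗[ℂ] A) : BiL2 φ :=
  ((TensorProduct.map (toL2 φ) (toL2 φ) x : φ.GNS ⊗[ℂ] φ.GNS) : BiL2 φ)

/-- `U ♯ V = W` in `L²(A ⊗ A, φ ⊗ φ)`: the product `♯` is extended from `A ⊗ A` by taking the
closure of its graph, so `U ♯ V = W` when `xₖ → U`, `yₖ → V` and `xₖ ♯ yₖ → W` in `L²` for some
`xₖ, yₖ` in `A ⊗ A`. As `‖x ♯ y‖₁ ≤ ‖x‖₂ ‖y‖₂`, such a `W` is determined by `U` and `V`: it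
is the product `U ♯ V` formed in `L¹(A ⊗ A, φ ⊗ φ)`. -/
def IsSharp (φ : A →ₚ[ℂ] ℂ) (U V W : BiL2 φ) : Prop :=
  (U, V, W) ∈ closure (Set.range fun z : (A ⊗[ℂ] A) × (A ⊗[ℂ] A) =>
    (toBiL2 φ z.1, toBiL2 φ z.2, toBiL2 φ (sharp z.1 z.2)))

/-! ### Bicontractions -/

section Bicontraction

variable {n₁ m₁ n₂ m₂ p r : ℕ}

/-- `(t₁, …, t_{n₁-p}, s_p, …, s₁)` -/
def argF₁ (hp : p ≤ min n₁ n₂) (t : Fin (n₁ + n₂ - 2 * p) → ℝ) (s : Fin p → ℝ) : Fin n₁ → ℝ :=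
  fun i => if h : (i : ℕ) < n₁ - p then t ⟨i, by omega⟩
    else s (Fin.rev ⟨i - (n₁ - p), by omega⟩)

/-- `(s₁, …, s_p, t_{n₁-p+1}, …, t_{n₁+n₂-2p})` -/
def argG₁ (hp : p ≤ min n₁ n₂) (t : Fin (n₁ + n₂ - 2 * p) → ℝ) (s : Fin p → ℝ) : Fin n₂ → ℝ :=
  fun i => if h : (i : ℕ) < p then s ⟨i, h⟩ else t ⟨n₁ - p + (i - p), by omega⟩

/-- `(y₁, …, y_r, u_{m₂-r+1}, …, u_{m₁+m₂-2r})` -/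
def argF₂ (hr : r ≤ min m₁ m₂) (u : Fin (m₁ + m₂ - 2 * r) → ℝ) (y : Fin r → ℝ) : Fin m₁ → ℝ :=
  fun j => if h : (j : ℕ) < r then y ⟨j, h⟩ else u ⟨m₂ - r + (j - r), by omega⟩

/-- `(u₁, …, u_{m₂-r}, y_r, …, y₁)` -/
def argG₂ (hr : r ≤ min m₁ m₂) (u : Fin (m₁ + m₂ - 2 * r) → ℝ) (y : Fin r → ℝ) : Fin m₂ → ℝ :=
  fun j => if h : (j : ℕ) < m₂ - r then u ⟨j, by omega⟩
    else y (Fin.rev ⟨j - (m₂ - r), by omega⟩)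

/-- The function `(t, u) ↦ ∫ f(t₁, …, t_{n₁-p}, s_p, …, s₁; y₁, …, y_r, u_{m₂-r+1}, …, u_{m₁+m₂-2r})
g(s₁, …, s_p, t_{n₁-p+1}, …, t_{n₁+n₂-2p}; u₁, …, u_{m₂-r}, y_r, …, y₁) ds dy`. -/
def bicontractionFun (hp : p ≤ min n₁ n₂) (hr : r ≤ min m₁ m₂)
    (f : L2Tensor n₁ m₁) (g : L2Tensor n₂ m₂)
    (z : (Fin (n₁ + n₂ - 2 * p) → ℝ) × (Fin (m₁ + m₂ - 2 * r) → ℝ)) : ℂ :=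
  ∫ w : (Fin p → ℝ) × (Fin r → ℝ),
    f (argF₁ hp z.1 w.1, argF₂ hr z.2 w.2) * g (argG₁ hp z.1 w.1, argG₂ hr z.2 w.2)
    ∂((leb p).prod (leb r))

open scoped Classical in
/-- The `(p, r)`-bicontraction of `f` and `g`, the class of `bicontractionFun` in `L²`. By the
Cauchy–Schwarz inequality that function is always square integrable, so the second branch never
occurs. -/
def bicontraction (hp : p ≤ min n₁ n₂) (hr : r ≤ min m₁ m₂)
    (f : L2Tensor n₁ m₁) (g : L2Tensor n₂ m₂) :
    L2Tensor (n₁ + n₂ - 2 * p) (m₁ + m₂ - 2 * r) :=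
  if h : MemLp (bicontractionFun hp hr f g) 2
      ((leb (n₁ + n₂ - 2 * p)).prod (leb (m₁ + m₂ - 2 * r)))
  then h.toLp _ else 0

end Bicontraction

end WignerSpace

end

/-!
Let `V` be the real vector space with basis `δ_t`, `t ≥ 0`, where `δ_t` stands for the function
`𝟙_[0,t)`, with the bilinear form `⟨δ_s, δ_t⟩ = min s t` (`minForm`) and the linear map `δ_t ↦ S t`
(`brownianMap`). To a list of vectors one attaches its *Wick word* (`wick`), the noncommutative
polynomial in the `S t` in which the contractions of neighbouring letters are subtracted. Wick
words satisfy by pure algebra the product formula `wick_reverse_mul_wick`, whose coefficients are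
the pairings of the contracted letters.

The probabilistic input is that the trace of every nonempty Wick word vanishes
(`map_wick_eq_zero`). Wick words are multilinear, so the letters may be taken to be intervals
between consecutive times of a finite set. Cutting a word into its runs of the last interval and
the subwords in between writes its Wick word as an alternating product of centered elements of two
free algebras; a run of length `k` gives the `k`-th Chebyshev polynomial in an increment, which is
centered for the semicircle law.

With the product formula this yields `⟪W(R), W(Q)⟫ = ∏ ⟨R i, Q i⟩` for Wick words of the same
length, which is also the inner product in `L²(ℝ₊ⁿ)` of the rectangle functions of `R` and `Q`.
Off-diagonal boxes are total (`denseRange_box`), their rectangle functions are sent by the Wigner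
integral to the products of increments, and those are Wick words. So the Wigner integral exists, is
isometric, and sends *every* rectangle function, on or off the diagonals, to its Wick word
(`wignerIntegral_rect`).

For tensors of rectangle functions the bicontractions are explicit (`bicontraction_tensor_rect`),
and the biproduct formula is the product formula for Wick words in both tensor factors.
Bicontractions are compositions of square-integrable kernels up to a relabelling of the variables,
hence continuous by the Cauchy–Schwarz inequality (`bicontractionL`), and the formula passes to all
`f` and `g` by density. Uniqueness holds because, by traciality, `(x, y) ↦ ⟪a ⊗ b, x ♯ y⟫` is
bounded for the `L²` norms for all `a` and `b` (`exists_norm_inner_sharp_le`).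
-/

noncomputable section

namespace WignerSpace

universe u

/-! ### Wick words -/

section Wick

variable {V A : Type*} [AddCommGroup V] [Module ℝ V] [Ring A] [Algebra ℝ A]
  (B : V →ₗ[ℝ] V →ₗ[ℝ] ℝ) (X : V →ₗ[ℝ] A)

/-- The Wick word of a list of vectors: the noncommutative polynomial in the variables `X x` defined
by the recursion `x :: y :: l ↦ X x * (y :: l) - B x y • l`, in which every contraction, for the
covariance `B`, of two neighbouring letters is subtracted. -/
def wick : List V → A
  | [] => 1
  | [x] => X x
  | x :: y :: l => X x * wick (y :: l) - B x y • wick l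

@[simp] theorem wick_nil : wick B X [] = 1 := rfl
@[simp] theorem wick_singleton (x : V) : wick B X [x] = X x := rfl
theorem wick_cons_cons (x y : V) (l : List V) :
    wick B X (x :: y :: l) = X x * wick B X (y :: l) - B x y • wick B X l := rfl

variable {B X}

theorem list_induction_two {α : Type*} {P : List α → Prop} (h0 : P []) (h1 : ∀ x, P [x])
    (h2 : ∀ x y l, P l → P (y :: l) → P (x :: y :: l)) : ∀ l, P l
  | [] => h0
  | [x] => h1 x
  | x :: y :: l => h2 x y l (list_induction_two h0 h1 h2 l) (list_induction_two h0 h1 h2 (y :: l))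

/-- Multiplying two Wick words either concatenates them or contracts the two letters that meet. -/
theorem wick_append_mul_wick_cons (R : List V) (x y : V) (R' : List V) :
    wick B X (R ++ [x]) * wick B X (y :: R') =
      wick B X (R ++ x :: y :: R') + B x y • (wick B X R * wick B X R') := by
  induction R using list_induction_two with
  | h0 => simp [wick_cons_cons]
  | h1 z =>
    simp only [List.cons_append, List.nil_append, wick_cons_cons, wick_singleton, wick_nil]
    simp [sub_mul, mul_sub, mul_assoc]
    abel
  | h2 z w l ih1 ih2 =>
    simp only [List.cons_append, wick_cons_cons] at ih1 ih2 ⊢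
    rw [sub_mul, mul_assoc, ih2, smul_mul_assoc, ih1]
    simp only [mul_add, sub_mul, smul_add, smul_sub, mul_smul_comm, smul_mul_assoc, mul_assoc,
      smul_comm (B z w) (B x y)]
    abel

/-- The product formula for Wick words. The first word is written backwards, so that the `p`
contracted pairs are the first `p` letters of either list. -/
theorem wick_reverse_mul_wick (U R : List V) :
    wick B X U.reverse * wick B X R =
      ∑ p ∈ Finset.range (min U.length R.length + 1),
        ((List.zipWith (fun x y => B x y) (U.take p) (R.take p)).prod) •
          wick B X ((U.drop p).reverse ++ R.drop p) := by
  induction U generalizing R with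
  | nil => simp
  | cons x U ih =>
    cases R with
    | nil => simp
    | cons y R =>
      rw [List.reverse_cons, wick_append_mul_wick_cons, ih, List.length_cons, List.length_cons,
        Nat.succ_min_succ, Finset.sum_range_succ' _ (_ + 1), add_comm]
      congr 1
      · simp [Finset.smul_sum, mul_smul]
      · simp

/-- The Wick word of a concatenation is a product as soon as the two letters at the junction are
orthogonal; no other pair of letters matters. -/
theorem wick_append_of_orthogonal (a b : List V)
    (h : ∀ x ∈ a.getLast?, ∀ y ∈ b.head?, B x y = 0) :
    wick B X (a ++ b) = wick B X a * wick B X b := by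
  rcases List.eq_nil_or_concat a with rfl | ⟨R, x, rfl⟩
  · simp
  · cases b with
    | nil => simp
    | cons y R' =>
      have hxy : B x y = 0 := h x (by simp) y (by simp)
      have := wick_append_mul_wick_cons (B := B) (X := X) R x y R'
      rw [hxy, zero_smul, add_zero] at this
      simpa using this.symm

theorem wick_mem {S : Subalgebra ℝ A} (l : List V) (h : ∀ x ∈ l, X x ∈ S) : wick B X l ∈ S := by
  induction l using list_induction_two with
  | h0 => exact S.one_mem
  | h1 x => simpa using h
  | h2 x y l ih1 ih2 =>
    simp only [List.mem_cons, forall_eq_or_imp] at h ih1 ih2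
    exact S.sub_mem (S.mul_mem h.1 (ih2 h.2)) (S.smul_mem (ih1 h.2.2) _)

theorem star_wick_reverse [StarRing A] [StarModule ℝ A] (hB : ∀ x y, B x y = B y x)
    (hX : ∀ x, star (X x) = X x) (l : List V) : star (wick B X l.reverse) = wick B X l := by
  induction l using list_induction_two with
  | h0 => simp
  | h1 x => simp [hX]
  | h2 x y l ih1 ih2 =>
    have := wick_append_mul_wick_cons (B := B) (X := X) l.reverse y x []
    have h : wick B X (x :: y :: l).reverse =
        wick B X (y :: l).reverse * X x - B x y • wick B X l.reverse := by
      rw [wick_nil, wick_singleton, mul_one, hB y x] at this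
      simp [this]
    rw [h, star_sub, star_mul, star_smul, ih1, ih2, hX, wick_cons_cons, star_trivial]

theorem star_wick [StarRing A] [StarModule ℝ A] (hB : ∀ x y, B x y = B y x)
    (hX : ∀ x, star (X x) = X x) (l : List V) : star (wick B X l) = wick B X l.reverse := by
  simpa using star_wick_reverse hB hX l.reverse

/-- Wick words are linear in each letter. -/
theorem wick_append_cons_linear (a b : List V) :
    ∃ L : V →ₗ[ℝ] A, ∀ x, L x = wick B X (a ++ x :: b) := by
  induction a using list_induction_two with
  | h0 =>
    cases b with
    | nil => exact ⟨X, fun x => rfl⟩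
    | cons y b =>
      refine ⟨(LinearMap.mulRight ℝ (wick B X (y :: b))) ∘ₗ X -
        (B.flip y).smulRight (wick B X b), fun x => ?_⟩
      simp [wick_cons_cons]
  | h1 z =>
    obtain ⟨L, hL⟩ : ∃ L : V →ₗ[ℝ] A, ∀ x, L x = wick B X (x :: b) := by
      cases b with
      | nil => exact ⟨X, fun x => rfl⟩
      | cons y b =>
        refine ⟨(LinearMap.mulRight ℝ (wick B X (y :: b))) ∘ₗ X -
          (B.flip y).smulRight (wick B X b), fun x => ?_⟩
        simp [wick_cons_cons]
    refine ⟨(LinearMap.mulLeft ℝ (X z)) ∘ₗ L - (B z).smulRight (wick B X b), fun x => ?_⟩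
    simp [wick_cons_cons, hL]
  | h2 z w l ih1 ih2 =>
    obtain ⟨L1, h1⟩ := ih1
    obtain ⟨L2, h2⟩ := ih2
    refine ⟨(LinearMap.mulLeft ℝ (X z)) ∘ₗ L2 - B z w • L1, fun x => ?_⟩
    simp [wick_cons_cons, h1, h2]

theorem wick_eq_zero_of_span {M : Type*} [AddCommGroup M] [Module ℝ M] (φ : A →ₗ[ℝ] M) (G : Set V)
    (h : ∀ l : List V, l ≠ [] → (∀ x ∈ l, x ∈ G) → φ (wick B X l) = 0)
    (l : List V) (hl : l ≠ []) (hm : ∀ x ∈ l, x ∈ Submodule.span ℝ G) : φ (wick B X l) = 0 := by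
  have key : ∀ v u : List V, (∀ x ∈ u, x ∈ G) → (∀ x ∈ v, x ∈ Submodule.span ℝ G) → u ++ v ≠ [] →
      φ (wick B X (u ++ v)) = 0 := by
    intro v
    induction v with
    | nil => intro u hu _ hne; exact h _ hne (by simpa using hu)
    | cons x v ih =>
      intro u hu hv _
      obtain ⟨L, hL⟩ := wick_append_cons_linear (B := B) (X := X) u v
      have hle : Submodule.span ℝ G ≤ LinearMap.ker (φ ∘ₗ L) := by
        rw [Submodule.span_le]
        intro y hy
        have := ih (u ++ [y]) (by
            intro z hz
            simp only [List.mem_append, List.mem_singleton] at hz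
            rcases hz with hz | rfl
            exacts [hu z hz, hy])
          (fun z hz => hv z (by simp [hz])) (by simp)
        simpa [hL] using this
      have := hle (hv x (by simp))
      simpa [hL] using this
  exact key l [] (by simp) hm hl

/-- Orthogonality of Wick words with respect to a functional that kills nonempty words. -/
theorem map_wick_mul_wick (φ : A →ₗ[ℝ] ℂ) (h1 : φ 1 = 1)
    (h : ∀ l : List V, l ≠ [] → φ (wick B X l) = 0) (U R : List V) (hl : U.length = R.length) :
    φ (wick B X U.reverse * wick B X R) = ((List.zipWith (fun x y => B x y) U R).prod : ℝ) := by
  induction U generalizing R with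
  | nil =>
    obtain rfl : R = [] := List.length_eq_zero_iff.1 hl.symm
    simp [h1]
  | cons x U ih =>
    cases R with
    | nil => simp at hl
    | cons y R =>
      rw [List.reverse_cons, wick_append_mul_wick_cons, map_add, h _ (by simp), map_smul,
        ih R (by simpa using hl)]
      simp

end Wick

/-! ### Chebyshev polynomials and the semicircle law -/

section Semicircle

open Polynomial in
/-- The monic orthogonal polynomials of the semicircle law of variance `σ`, i.e. the rescaled
Chebyshev polynomials of the second kind. -/
def chebyshev (σ : ℝ) : ℕ → ℝ[X]
  | 0 => 1
  | 1 => X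
  | k + 2 => X * chebyshev σ (k + 1) - C σ * chebyshev σ k

/-- The Wick word of a constant list is a Chebyshev polynomial. -/
theorem wick_replicate {V A : Type*} [AddCommGroup V] [Module ℝ V] [Ring A] [Algebra ℝ A]
    (B : V →ₗ[ℝ] V →ₗ[ℝ] ℝ) (X : V →ₗ[ℝ] A) (e : V) (k : ℕ) :
    wick B X (List.replicate k e) = Polynomial.aeval (X e) (chebyshev (B e e) k) := by
  induction k using Nat.twoStepInduction with
  | zero => simp [chebyshev]
  | one => simp [chebyshev]
  | more k ih1 ih2 =>
    rw [List.replicate_succ, List.replicate_succ, wick_cons_cons, ← List.replicate_succ, ih1, ih2]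
    simp [chebyshev, Algebra.smul_def]

theorem chebyshev_eval_cos {σ : ℝ} (hσ : 0 ≤ σ) (k : ℕ) (θ : ℝ) :
    (chebyshev σ k).eval (2 * √σ * Real.cos θ) * Real.sin θ =
      √σ ^ k * Real.sin ((k + 1) * θ) := by
  induction k using Nat.twoStepInduction with
  | zero => simp [chebyshev]
  | one =>
    simp only [chebyshev, Polynomial.eval_X, pow_one, Nat.cast_one]
    rw [show ((1 : ℝ) + 1) * θ = 2 * θ by ring, Real.sin_two_mul]
    ring
  | more k ih1 ih2 =>
    simp only [chebyshev, Polynomial.eval_sub, Polynomial.eval_mul, Polynomial.eval_X,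
      Polynomial.eval_C, sub_mul, mul_assoc] at ih1 ih2 ⊢
    rw [ih1, ih2]
    have hs : √σ ^ 2 = σ := Real.sq_sqrt hσ
    have h1 : Real.sin (((k + 2 : ℕ) + 1 : ℝ) * θ) + Real.sin (((k : ℝ) + 1) * θ) =
        2 * Real.sin (((k + 1 : ℕ) + 1 : ℝ) * θ) * Real.cos θ := by
      have h2 := Real.sin_add (((k + 1 : ℕ) + 1 : ℝ) * θ) θ
      have h3 := Real.sin_sub (((k + 1 : ℕ) + 1 : ℝ) * θ) θ
      rw [show (((k + 1 : ℕ) + 1 : ℝ) * θ) + θ = (((k + 2 : ℕ) + 1 : ℝ) * θ) by push_cast; ring]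
        at h2
      rw [show (((k + 1 : ℕ) + 1 : ℝ) * θ) - θ = (((k : ℝ) + 1) * θ) by push_cast; ring] at h3
      rw [h2, h3]
      ring
    linear_combination (-√σ ^ (k + 2)) * h1 + √σ ^ k * Real.sin (((k : ℝ) + 1) * θ) * hs

theorem integral_semicircular {σ : ℝ} (hσ : 0 < σ) (g : ℝ → ℝ) :
    ∫ y, g y ∂semicircular σ = ∫ y, (2 * Real.pi * σ)⁻¹ * √(4 * σ - y ^ 2) * g y := by
  rw [semicircular, integral_withDensity_eq_integral_toReal_smul (by fun_prop) (by simp)]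
  refine integral_congr_ae (Filter.Eventually.of_forall fun y => ?_)
  simp only [smul_eq_mul]
  rw [ENNReal.toReal_ofReal (by positivity)]

theorem sqrt_semicircle_eq_zero {σ y : ℝ} (hσ : 0 < σ) (hy : y ∉ Set.Icc (-(2 * √σ)) (2 * √σ)) :
    √(4 * σ - y ^ 2) = 0 := by
  apply Real.sqrt_eq_zero_of_nonpos
  by_contra! h
  apply hy
  have : |y| ≤ 2 * √σ := by
    apply abs_le_of_sq_le_sq _ (by positivity)
    rw [mul_pow, Real.sq_sqrt hσ.le]
    linarith
  exact abs_le.1 this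

theorem integrable_semicircular {σ : ℝ} (hσ : 0 < σ) {g : ℝ → ℝ} (hg : Continuous g) :
    Integrable g (semicircular σ) := by
  rw [semicircular, integrable_withDensity_iff_integrable_smul₀' (by fun_prop) (by simp)]
  have h : Continuous fun y : ℝ => (ENNReal.ofReal ((2 * Real.pi * σ)⁻¹ * √(4 * σ - y ^ 2))).toReal
      • g y := by
    have : (fun y : ℝ => (ENNReal.ofReal ((2 * Real.pi * σ)⁻¹ * √(4 * σ - y ^ 2))).toReal • g y) =
        fun y => (2 * Real.pi * σ)⁻¹ * √(4 * σ - y ^ 2) * g y := by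
      ext y
      rw [ENNReal.toReal_ofReal (by positivity), smul_eq_mul]
    rw [this]
    fun_prop
  refine h.integrable_of_hasCompactSupport
    (HasCompactSupport.intro (isCompact_Icc (a := -(2 * √σ)) (b := 2 * √σ)) fun y hy => ?_)
  simp [sqrt_semicircle_eq_zero hσ hy]

theorem integral_sin_mul_sin {k : ℕ} (hk : k ≠ 0) :
    ∫ θ in (0 : ℝ)..Real.pi, Real.sin θ * Real.sin ((k + 1) * θ) = 0 := by
  have h : ∀ θ : ℝ, Real.sin θ * Real.sin ((k + 1) * θ) =
      2⁻¹ * (Real.cos (k * θ) - Real.cos (((k + 2 : ℕ) : ℝ) * θ)) := by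
    intro θ
    have h1 := Real.cos_sub ((k + 1) * θ) θ
    have h2 := Real.cos_add ((k + 1) * θ) θ
    rw [show ((k : ℝ) + 1) * θ - θ = k * θ by ring] at h1
    rw [show ((k : ℝ) + 1) * θ + θ = ((k + 2 : ℕ) : ℝ) * θ by push_cast; ring] at h2
    rw [h1, h2]
    ring
  have hc : ∀ m : ℕ, m ≠ 0 → ∫ θ in (0 : ℝ)..Real.pi, Real.cos (m * θ) = 0 := by
    intro m hm
    rw [intervalIntegral.integral_comp_mul_left (fun x => Real.cos x) (by exact_mod_cast hm),
      integral_cos]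
    simp
  simp_rw [h]
  rw [intervalIntegral.integral_const_mul, intervalIntegral.integral_sub, hc k hk,
    hc _ (by omega)]
  · simp
  all_goals exact Continuous.intervalIntegrable (by fun_prop) _ _

/-- The polynomials of positive degree are orthogonal to `1`. After the substitution
`y = 2√σ cos θ` this is the orthogonality of `sin θ` and `sin ((k + 1) θ)` on `[0, π]`. -/
theorem integral_chebyshev {σ : ℝ} (hσ : 0 < σ) {k : ℕ} (hk : k ≠ 0) :
    ∫ y, (chebyshev σ k).eval y ∂semicircular σ = 0 := by
  rw [integral_semicircular hσ]
  set g : ℝ → ℝ := fun y => (2 * Real.pi * σ)⁻¹ * √(4 * σ - y ^ 2) * (chebyshev σ k).eval y with hg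
  have hgc : Continuous g := by fun_prop
  have h1 : ∫ y, g y = ∫ y in (-(2 * √σ))..(2 * √σ), g y := by
    rw [intervalIntegral.integral_of_le (by linarith [Real.sqrt_nonneg σ]),
      ← integral_Icc_eq_integral_Ioc, setIntegral_eq_integral_of_forall_compl_eq_zero]
    intro y hy
    simp [hg, sqrt_semicircle_eq_zero hσ hy]
  have h2 := intervalIntegral.integral_comp_mul_deriv (a := 0) (b := Real.pi)
    (f := fun θ => 2 * √σ * Real.cos θ) (f' := fun θ => 2 * √σ * -Real.sin θ) (g := g)
    (fun θ _ => (Real.hasDerivAt_cos θ).const_mul _) (by fun_prop) hgc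
  rw [h1, intervalIntegral.integral_symm, ← neg_zero]
  congr 1
  simp only [Real.cos_zero, mul_one, Real.cos_pi, mul_neg (2 * √σ)] at h2
  rw [← h2]
  have h3 : ∀ θ ∈ Set.uIcc 0 Real.pi, (g ∘ fun θ => 2 * √σ * Real.cos θ) θ * -(2 * √σ * Real.sin θ)
      = (-(2 * Real.pi * σ)⁻¹ * (4 * σ) * √σ ^ k) * (Real.sin θ * Real.sin ((k + 1) * θ)) := by
    intro θ hθ
    rw [Set.uIcc_of_le Real.pi_pos.le] at hθ
    have hs : √(4 * σ - (2 * √σ * Real.cos θ) ^ 2) = 2 * √σ * Real.sin θ := by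
      have h6 : 4 * σ - (2 * √σ * Real.cos θ) ^ 2 = (2 * √σ * Real.sin θ) ^ 2 := by
        rw [mul_pow, mul_pow, mul_pow, mul_pow, Real.sq_sqrt hσ.le, Real.sin_sq]
        ring
      rw [h6, Real.sqrt_sq]
      have := Real.sin_nonneg_of_mem_Icc hθ
      positivity
    simp only [Function.comp, hg, hs]
    have h4 := chebyshev_eval_cos hσ.le k θ
    have h5 := Real.sq_sqrt hσ.le
    linear_combination (-(2 * Real.pi * σ)⁻¹ * 4 * √σ ^ 2 * Real.sin θ) * h4 -
      ((2 * Real.pi * σ)⁻¹ * 4 * √σ ^ k * Real.sin ((k + 1) * θ) * Real.sin θ) * h5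
  rw [intervalIntegral.integral_congr h3, intervalIntegral.integral_const_mul,
    integral_sin_mul_sin hk, mul_zero]

end Semicircle

/-! ### Wick words of a free Brownian motion -/

section Law

variable {A : Type*} [CStarAlgebra A] [PartialOrder A]

theorem HasLaw.map_aeval {φ : A →ₚ[ℂ] ℂ} {x : A} {σ : ℝ} (hσ : 0 < σ)
    (h : HasLaw φ x (semicircular σ)) (q : Polynomial ℝ) :
    φ (Polynomial.aeval x q) = ((∫ y, q.eval y ∂semicircular σ : ℝ) : ℂ) := by
  rw [Polynomial.aeval_eq_sum_range, map_sum]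
  simp_rw [Polynomial.eval_eq_sum_range]
  rw [integral_finsetSum _ fun i _ => integrable_semicircular hσ (by fun_prop)]
  push_cast
  refine Finset.sum_congr rfl fun i _ => ?_
  rw [integral_const_mul, ← Complex.coe_smul, map_smul, h i]
  simp

/-- Free independence, stated for lists of tagged centered elements. -/
theorem Free.prod_list {φ : A →ₚ[ℂ] ℂ} {ι : Type*} {B : ι → Subalgebra ℂ A} (h : Free φ B)
    (l : List (ι × A)) (hl : l ≠ []) (hm : ∀ p ∈ l, p.2 ∈ B p.1) (h0 : ∀ p ∈ l, φ p.2 = 0)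
    (hc : l.IsChain fun p q => p.1 ≠ q.1) : φ (l.map Prod.snd).prod = 0 := by
  obtain ⟨n, hn⟩ : ∃ n, l.length = n + 1 :=
    ⟨l.length - 1, by have := List.length_pos_iff.2 hl; omega⟩
  have := h n (fun k => (l.get (k.cast hn.symm)).1) (fun k => (l.get (k.cast hn.symm)).2)
    (fun k => hm _ (List.get_mem _ _)) (fun k => h0 _ (List.get_mem _ _))
    (fun k => by
      have := List.isChain_iff_getElem.1 hc k (by omega)
      simpa using this)
  convert this using 3
  refine List.ext_getElem (by simp [hn]) fun i h1 h2 => ?_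
  rw [List.getElem_ofFn]
  simp

end Law

section BrownianWords

theorem wick_flatten {V A : Type*} [AddCommGroup V] [Module ℝ V] [Ring A] [Algebra ℝ A]
    {B : V →ₗ[ℝ] V →ₗ[ℝ] ℝ} {X : V →ₗ[ℝ] A} (L : List (List V)) (hne : [] ∉ L)
    (h : L.IsChain fun a b => ∀ x ∈ a.getLast?, ∀ y ∈ b.head?, B x y = 0) :
    wick B X L.flatten = (L.map (wick B X)).prod := by
  induction L with
  | nil => simp
  | cons m L ih =>
    rw [List.flatten_cons, List.map_cons, List.prod_cons, wick_append_of_orthogonal,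
      ih (fun h' => hne (by simp [h'])) h.tail]
    intro x hx y hy
    cases L with
    | nil => simp at hy
    | cons m' L =>
      have hm' : m' ≠ [] := fun h' => hne (by simp [h'])
      obtain ⟨z, m', rfl⟩ := List.exists_cons_of_ne_nil hm'
      rw [List.isChain_cons_cons] at h
      exact h.1 x hx y (by simpa using hy)

/-- The covariance of Brownian motion as a bilinear form on the free real vector space over the
times: `⟨δ_s, δ_t⟩ = min s t`. The basis vector `δ_t` stands for `𝟙_[0,t)`. -/
def minForm : (ℝ≥0 →₀ ℝ) →ₗ[ℝ] (ℝ≥0 →₀ ℝ) →ₗ[ℝ] ℝ :=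
  Finsupp.linearCombination ℝ fun s =>
    Finsupp.linearCombination ℝ fun t => ((min s t : ℝ≥0) : ℝ)

@[simp] theorem minForm_single (s t : ℝ≥0) :
    minForm (Finsupp.single s 1) (Finsupp.single t 1) = ((min s t : ℝ≥0) : ℝ) := by
  simp [minForm]

theorem minForm_comm (v w : ℝ≥0 →₀ ℝ) : minForm v w = minForm w v := by
  suffices minForm = minForm.flip from congrArg (fun f => f v w) this
  ext s t
  simp [min_comm]

variable {A : Type*} [CStarAlgebra A]

/-- The Wiener integral of step functions, i.e. the real-linear extension of `δ_t ↦ S_t`. -/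
def brownianMap (S : ℝ≥0 → A) : (ℝ≥0 →₀ ℝ) →ₗ[ℝ] A := Finsupp.linearCombination ℝ S

@[simp] theorem brownianMap_single (S : ℝ≥0 → A) (s : ℝ≥0) :
    brownianMap S (Finsupp.single s 1) = S s := by
  simp [brownianMap]

theorem star_brownianMap {S : ℝ≥0 → A} (hS : ∀ t, IsSelfAdjoint (S t)) (v : ℝ≥0 →₀ ℝ) :
    star (brownianMap S v) = brownianMap S v := by
  induction v using Finsupp.induction_linear with
  | zero => simp
  | add v w hv hw => simp [hv, hw]
  | single t c => simp [brownianMap, (hS t).star_eq]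

/-- The vector `δ_t - δ_u`, which stands for `𝟙_[u,t)`. -/
abbrev interval (u t : ℝ≥0) : ℝ≥0 →₀ ℝ := Finsupp.single t 1 - Finsupp.single u 1

variable [WStarAlgebra A] [PartialOrder A] [StarOrderedRing A] {φ : A →ₚ[ℂ] ℂ}
  {F : ℝ≥0 → StarSubalgebra ℂ A} {S : ℝ≥0 → A}

/-- A word over `G` and one later interval `[u, t)` is cut into maximal runs of `[u, t)` and maximal
subwords over `G`. Neighbouring blocks are orthogonal, so the Wick word is the product of the Wick
words of the blocks. Those are centered (the runs of `[u, t)` by the orthogonality of the Chebyshev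
polynomials) and alternate between the algebra of the increment `S t - S u` and `F u`, so freeness
applies. -/
theorem map_wick_eq_zero_of_insert
    (hS : IsFreeBrownianMotion φ F S) {u t : ℝ≥0} (hut : u < t) (G : Set (ℝ≥0 →₀ ℝ))
    (hGF : ∀ v ∈ G, brownianMap S v ∈ F u) (hG0 : ∀ v ∈ G, minForm (interval u t) v = 0)
    (hG : ∀ l : List (ℝ≥0 →₀ ℝ), l ≠ [] → (∀ x ∈ l, x ∈ G) →
      φ (wick minForm (brownianMap S) l) = 0)
    (l : List (ℝ≥0 →₀ ℝ)) (hl : l ≠ []) (hm : ∀ x ∈ l, x = interval u t ∨ x ∈ G) :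
    φ (wick minForm (brownianMap S) l) = 0 := by
  classical
  set e := interval u t with he
  have hee : minForm e e = (t : ℝ) - u := by
    simp [he, interval, min_eq_left hut.le, min_eq_right hut.le]
  have hXe : brownianMap S e = S t - S u := by simp [he, interval]
  have hσ : (0 : ℝ) < (t : ℝ) - u := by simpa using hut
  set r : (ℝ≥0 →₀ ℝ) → (ℝ≥0 →₀ ℝ) → Bool := fun a b => decide (a = e) == decide (b = e) with hr
  set L := l.splitBy r with hL
  have hne : [] ∉ L := List.nil_notMem_splitBy _ _
  -- a block consists of copies of `e` or of other vectors
  have hblock : ∀ m ∈ L, ∀ x ∈ m, ∀ y ∈ m, x = e → y = e := by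
    intro m hm' x hx y hy hxe
    have hc := List.isChain_of_mem_splitBy hm'
    have htr : ∀ a b : ℝ≥0 →₀ ℝ, r a b = true ↔ (a = e ↔ b = e) := by simp [hr]
    simp only [htr] at hc
    have : IsTrans (ℝ≥0 →₀ ℝ) (fun a b => (a = e ↔ b = e)) := ⟨fun _ _ _ h1 h2 => h1.trans h2⟩
    rw [List.isChain_iff_pairwise] at hc
    have := List.Pairwise.forall_of_forall (R := fun a b => (a = e ↔ b = e))
      (fun _ _ => Iff.rfl) hc hx hy
    exact this.1 hxe
  have hlL : ∀ m ∈ L, ∀ x ∈ m, x ∈ l := by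
    intro m hm' x hx
    rw [← List.flatten_splitBy r l]
    exact List.mem_flatten.2 ⟨m, hm', hx⟩
  have hchain := List.isChain_getLast_head_splitBy r l
  rw [← hL] at hchain
  have hrep : ∀ m ∈ L, e ∈ m → m = List.replicate m.length e := fun m hm' hem =>
    List.eq_replicate_iff.2 ⟨rfl, fun y hy => hblock m hm' e hem y hy rfl⟩
  have hrest : ∀ m ∈ L, e ∉ m → ∀ x ∈ m, x ∈ G := by
    intro m hm' hem x hx
    rcases hm x (hlL m hm' x hx) with rfl | h
    exacts [absurd hx hem, h]
  have hprod : wick minForm (brownianMap S) l = (L.map (wick minForm (brownianMap S))).prod := by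
    conv_lhs => rw [← List.flatten_splitBy r l]
    refine wick_flatten _ hne ?_
    refine List.IsChain.imp_of_mem_imp ?_ hchain
    rintro a b ha hb ⟨ha', hb', hab⟩ x hx y hy
    rw [List.getLast?_eq_getLast_of_ne_nil ha', Option.mem_def, Option.some_inj] at hx
    rw [List.head?_eq_some_head hb', Option.mem_def, Option.some_inj] at hy
    rw [hx, hy] at hab
    have hxa : x ∈ a := hx ▸ List.getLast_mem ha'
    have hyb : y ∈ b := hy ▸ List.head_mem hb'
    have hx' := hm x (hlL a ha x hxa)
    have hy' := hm y (hlL b hb y hyb)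
    by_cases hxe : x = e <;> by_cases hye : y = e
    · simp [hr, hxe, hye] at hab
    · rw [hxe]; exact hG0 y (hy'.resolve_left hye)
    · rw [hye, minForm_comm]; exact hG0 x (hx'.resolve_left hxe)
    · simp [hr, hxe, hye] at hab
  have hfree := (hS.free u t hut).prod_list
    (L.map fun m => ((if e ∈ m then 0 else 1 : Fin 2), wick minForm (brownianMap S) m))
    (by simpa [hL] using hl) ?_ ?_ ?_
  · rw [hprod]
    simpa [Function.comp_def] using hfree
  · intro p hp
    obtain ⟨m, hm', rfl⟩ := List.mem_map.1 hp
    by_cases hem : e ∈ m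
    · simp only [hem, if_true, Matrix.cons_val_zero]
      have hsub : ∀ x ∈ m, brownianMap S x ∈
          (Algebra.adjoin ℂ {S t - S u}).restrictScalars ℝ := by
        intro x hx
        rw [hblock m hm' e hem x hx rfl, hXe, Subalgebra.mem_restrictScalars]
        exact Algebra.subset_adjoin (Set.mem_singleton _)
      exact (Subalgebra.mem_restrictScalars ℝ).1 (wick_mem m hsub)
    · simp only [hem, if_false, Matrix.cons_val_one]
      have hsub : ∀ x ∈ m, brownianMap S x ∈ (F u).toSubalgebra.restrictScalars ℝ :=
        fun x hx => hGF x (hrest m hm' hem x hx)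
      exact (Subalgebra.mem_restrictScalars ℝ).1 (wick_mem m hsub)
  · intro p hp
    obtain ⟨m, hm', rfl⟩ := List.mem_map.1 hp
    by_cases hem : e ∈ m
    · have hlen : m.length ≠ 0 := by
        intro h
        exact hne (List.length_eq_zero_iff.1 h ▸ hm')
      simp only
      rw [hrep m hm' hem, wick_replicate, hee]
      rw [hXe, (hS.law_increment u t hut).map_aeval hσ, integral_chebyshev hσ hlen]
      simp
    · exact hG m (fun h => hne (h ▸ hm')) (hrest m hm' hem)
  · rw [List.isChain_map]
    refine List.IsChain.imp_of_mem_imp ?_ hchain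
    rintro a b ha hb ⟨ha', hb', hab⟩
    have h1 : e ∈ a ↔ a.getLast ha' = e :=
      ⟨fun h => hblock a ha e h _ (List.getLast_mem ha') rfl, fun h => h ▸ List.getLast_mem ha'⟩
    have h2 : e ∈ b ↔ b.head hb' = e :=
      ⟨fun h => hblock b hb e h _ (List.head_mem hb') rfl, fun h => h ▸ List.head_mem hb'⟩
    simp only [h1, h2]
    by_cases hxe : a.getLast ha' = e <;> by_cases hye : b.head hb' = e <;>
      simp [hr, hxe, hye] at hab ⊢

/-- Nonempty Wick words of a free Brownian motion are centered. This is the only place where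
freeness and the law of the increments enter. -/
theorem map_wick_eq_zero (hS : IsFreeBrownianMotion φ F S) (l : List (ℝ≥0 →₀ ℝ))
    (hl : l ≠ []) :
    φ (wick minForm (brownianMap S) l) = 0 := by
  classical
  let φ' : A →ₗ[ℝ] ℂ := φ.toLinearMap.restrictScalars ℝ
  -- the letters may be taken among `δ_0` and the `δ_s`, `s ∈ T`; the times in `T` are added in
  -- increasing order
  have key : ∀ T : Finset ℝ≥0, ∀ l : List (ℝ≥0 →₀ ℝ), l ≠ [] →
      (∀ x ∈ l, x ∈ (fun s : ℝ≥0 => (Finsupp.single s 1 : ℝ≥0 →₀ ℝ)) '' (insert 0 T : Finset ℝ≥0)) →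
      φ (wick minForm (brownianMap S) l) = 0 := by
    intro T
    induction T using Finset.induction_on_max with
    | empty =>
      intro l hl h
      obtain ⟨x, l, rfl⟩ := List.exists_cons_of_ne_nil hl
      have hx : x = Finsupp.single 0 1 := by simpa using (h x (by simp))
      cases l with
      | nil => simp [hx, hS.zero]
      | cons y l =>
        have hy : y = Finsupp.single 0 1 := by simpa using (h y (by simp))
        simp [wick_cons_cons, hx, hS.zero, hy]
    | insert t T hT ih =>
      rcases eq_or_ne t 0 with rfl | ht
      · simpa using ih
      set u := (insert 0 T).max' (by simp) with hu
      have hu_mem : u ∈ insert 0 T := Finset.max'_mem _ _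
      have hut : u < t := by
        rcases Finset.mem_insert.1 hu_mem with h | h
        · rw [h]; exact pos_iff_ne_zero.2 ht
        · exact hT u h
      set G := (fun s : ℝ≥0 => (Finsupp.single s 1 : ℝ≥0 →₀ ℝ)) '' (insert 0 T : Finset ℝ≥0)
        with hG
      have hstep := map_wick_eq_zero_of_insert hS hut G
        (by
          rintro _ ⟨s, hs, rfl⟩
          rw [brownianMap_single]
          exact hS.mono (Finset.le_max' _ _ hs) (hS.adapted s))
        (by
          rintro _ ⟨s, hs, rfl⟩
          have hsu : s ≤ u := Finset.le_max' _ _ hs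
          simp [interval, min_eq_right hsu, min_eq_right (hsu.trans hut.le)])
        ih
      intro l hl h
      refine wick_eq_zero_of_span φ' ({interval u t} ∪ G) (fun l hl h => hstep l hl ?_) l hl ?_
      · simpa using h
      · intro x hx
        obtain ⟨s, hs, rfl⟩ := h x hx
        have hsG : ∀ s ∈ insert 0 T, (Finsupp.single s 1 : ℝ≥0 →₀ ℝ) ∈
            Submodule.span ℝ ({interval u t} ∪ G) := fun s hs =>
          Submodule.subset_span (Or.inr ⟨s, hs, rfl⟩)
        simp only [Finset.coe_insert, Set.mem_insert_iff, Finset.mem_coe] at hs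
        rcases hs with rfl | rfl | hs
        · exact hsG 0 (by simp)
        · have h1 : (Finsupp.single s 1 : ℝ≥0 →₀ ℝ) = interval u s + Finsupp.single u 1 := by
            simp [interval]
          simp only
          rw [h1]
          exact Submodule.add_mem _ (Submodule.subset_span (Or.inl rfl)) (hsG u hu_mem)
        · exact hsG s (by simp [hs])
  refine wick_eq_zero_of_span φ' (Set.range fun s : ℝ≥0 => (Finsupp.single s 1 : ℝ≥0 →₀ ℝ))
    (fun l hl h => ?_) l hl fun x _ => ?_
  · choose! s hs using h
    refine key (l.map s).toFinset l hl fun x hx => ⟨s x, ?_, hs x hx⟩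
    simp only [Finset.coe_insert, Set.mem_insert_iff, Finset.mem_coe, List.mem_toFinset,
      List.mem_map]
    exact Or.inr ⟨x, hx, rfl⟩
  · clear * -
    induction x using Finsupp.induction_linear with
    | zero => exact Submodule.zero_mem _
    | add v w hv hw => exact Submodule.add_mem _ hv hw
    | single t c =>
      rw [← mul_one c, ← smul_eq_mul, ← Finsupp.smul_single]
      exact Submodule.smul_mem _ _ (Submodule.subset_span ⟨t, rfl⟩)

end BrownianWords

/-! ### Families with the same Gram matrix -/

section Gram

variable {E F ι κ : Type*} [NormedAddCommGroup E] [InnerProductSpace ℂ E] [NormedAddCommGroup F]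
  [InnerProductSpace ℂ F] {a : ι → E} {b : ι → F}

theorem norm_linearCombination_eq_of_gram (h : ∀ i j, inner ℂ (a i) (a j) = inner ℂ (b i) (b j))
    (c : ι →₀ ℂ) : ‖Finsupp.linearCombination ℂ b c‖ = ‖Finsupp.linearCombination ℂ a c‖ := by
  have hin : inner ℂ (Finsupp.linearCombination ℂ b c) (Finsupp.linearCombination ℂ b c) =
      inner ℂ (Finsupp.linearCombination ℂ a c) (Finsupp.linearCombination ℂ a c) := by
    simp only [Finsupp.linearCombination_apply, Finsupp.sum_inner, Finsupp.inner_sum,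
      inner_smul_left, inner_smul_right, h]
  rw [norm_eq_sqrt_re_inner (𝕜 := ℂ), norm_eq_sqrt_re_inner (𝕜 := ℂ), hin]

variable [CompleteSpace F] {σ : κ → ι}

/-- If two families have the same Gram matrix and a subfamily of the first is total, then the
continuous linear map that is fixed by its values on the subfamily carries the whole first family to
the second. -/
theorem extendOfNorm_apply_of_gram (h : ∀ i j, inner ℂ (a i) (a j) = inner ℂ (b i) (b j))
    (hd : DenseRange (Finsupp.linearCombination ℂ fun k => a (σ k))) (i : ι) :
    (Finsupp.linearCombination ℂ fun k => b (σ k)).extendOfNorm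
      (Finsupp.linearCombination ℂ fun k => a (σ k)) (a i) = b i := by
  set T := (Finsupp.linearCombination ℂ fun k => b (σ k)).extendOfNorm
      (Finsupp.linearCombination ℂ fun k => a (σ k)) with hT
  have hbd : ∃ C, ∀ c, ‖Finsupp.linearCombination ℂ (fun k => b (σ k)) c‖ ≤
      C * ‖Finsupp.linearCombination ℂ (fun k => a (σ k)) c‖ :=
    ⟨1, fun c => by rw [one_mul, norm_linearCombination_eq_of_gram fun i j => h (σ i) (σ j)]⟩
  have key : ∀ x, ‖T x - b i‖ = ‖x - a i‖ := by
    refine isClosed_property hd (isClosed_eq (by fun_prop) (by fun_prop)) fun c => ?_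
    rw [hT, LinearMap.extendOfNorm_eq hd hbd]
    have := norm_linearCombination_eq_of_gram h (c.mapDomain σ - Finsupp.single i 1)
    simpa [Finsupp.linearCombination_mapDomain, Function.comp_def] using this
  simpa [sub_eq_zero] using key (a i)

theorem norm_extendOfNorm_of_gram (h : ∀ i j, inner ℂ (a i) (a j) = inner ℂ (b i) (b j))
    (hd : DenseRange (Finsupp.linearCombination ℂ a)) (x : E) :
    ‖(Finsupp.linearCombination ℂ b).extendOfNorm (Finsupp.linearCombination ℂ a) x‖ = ‖x‖ := by
  refine isClosed_property (p := fun x => ‖(Finsupp.linearCombination ℂ b).extendOfNorm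
    (Finsupp.linearCombination ℂ a) x‖ = ‖x‖) hd
    (isClosed_eq (by fun_prop) (by fun_prop)) (fun c => ?_) x
  rw [LinearMap.extendOfNorm_eq hd ⟨1, fun c => ?_⟩, norm_linearCombination_eq_of_gram h]
  rw [one_mul, norm_linearCombination_eq_of_gram h]

end Gram

/-! ### Rectangle functions -/

section StepFunctions

/-- The step function of a vector, linear with `δ_t ↦ 𝟙_[0,t)`. -/
def step : (ℝ≥0 →₀ ℝ) →ₗ[ℝ] ℝ → ℝ :=
  Finsupp.linearCombination ℝ fun t => (Set.Ico (0 : ℝ) t).indicator 1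

theorem step_single (t : ℝ≥0) : step (Finsupp.single t 1) = (Set.Ico (0 : ℝ) t).indicator 1 := by
  simp [step]

theorem step_interval {a b : ℝ≥0} (hab : a ≤ b) :
    step (interval a b) = (Set.Ico (a : ℝ) b).indicator 1 := by
  have hab' : (a : ℝ) ≤ b := by exact_mod_cast hab
  have ha : (0 : ℝ) ≤ a := a.2
  rw [interval, map_sub, step_single, step_single]
  ext x
  simp only [Pi.sub_apply, Set.indicator_apply, Set.mem_Ico, Pi.one_apply]
  generalize (a : ℝ) = a at *
  generalize (b : ℝ) = b at *
  by_cases h1 : x < a <;> by_cases h2 : x < b <;> by_cases h3 : 0 ≤ x <;> by_cases h4 : a ≤ x <;>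
    simp [h1, h2, h3, h4] <;> linarith

theorem finsupp_single_induction {P : (ℝ≥0 →₀ ℝ) → Prop} (v : ℝ≥0 →₀ ℝ)
    (zero : P 0) (add : ∀ v w, P v → P w → P (v + w)) (smul : ∀ (c : ℝ) v, P v → P (c • v))
    (single : ∀ t, P (Finsupp.single t 1)) : P v := by
  induction v using Finsupp.induction_linear with
  | zero => exact zero
  | add v w hv hw => exact add v w hv hw
  | single t c =>
    rw [← mul_one c, ← smul_eq_mul, ← Finsupp.smul_single]
    exact smul _ _ (single t)

theorem measurable_step (v : ℝ≥0 →₀ ℝ) : Measurable (step v) := by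
  induction v using finsupp_single_induction with
  | zero => rw [map_zero]; exact measurable_const
  | add v w hv hw => simpa using hv.add hw
  | smul c v hv => simpa using hv.const_smul c
  | single t => rw [step_single]; exact measurable_one.indicator measurableSet_Ico

theorem memLp_step (v : ℝ≥0 →₀ ℝ) :
    MemLp (step v) 2 ((volume : Measure ℝ).restrict (Set.Ici 0)) := by
  induction v using finsupp_single_induction with
  | zero => simp
  | add v w hv hw => simpa using hv.add hw
  | smul c v hv => simpa using hv.const_smul c
  | single t =>
    rw [step_single]
    exact memLp_indicator_const 2 measurableSet_Ico 1
      (Or.inr ((Measure.restrict_apply_le _ _).trans_lt (by simp)).ne)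

theorem integrable_step_mul_step (v w : ℝ≥0 →₀ ℝ) :
    Integrable (fun x => step v x * step w x) ((volume : Measure ℝ).restrict (Set.Ici 0)) :=
  (memLp_step v).integrable_mul (memLp_step w)

theorem integral_step_mul_step (v w : ℝ≥0 →₀ ℝ) :
    ∫ x in Set.Ici (0 : ℝ), step v x * step w x = minForm v w := by
  induction v using finsupp_single_induction with
  | zero => simp
  | add v v' hv hv' =>
    simp only [map_add, Pi.add_apply, add_mul, LinearMap.add_apply]
    rw [integral_add (integrable_step_mul_step _ _) (integrable_step_mul_step _ _), hv, hv']
  | smul c v hv =>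
    simp only [map_smul, Pi.smul_apply, LinearMap.smul_apply, smul_mul_assoc]
    rw [integral_smul, hv]
  | single s =>
    induction w using finsupp_single_induction with
    | zero => simp
    | add v v' hv hv' =>
      simp only [map_add, Pi.add_apply, mul_add]
      rw [integral_add (integrable_step_mul_step _ _) (integrable_step_mul_step _ _), hv, hv']
    | smul c v hv =>
      simp only [map_smul, Pi.smul_apply, mul_smul_comm]
      rw [integral_smul, hv]
    | single t =>
      have h : ∀ x : ℝ, step (Finsupp.single s 1) x * step (Finsupp.single t 1) x =
          (Set.Ico (0 : ℝ) (min s t : ℝ≥0)).indicator 1 x := by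
        intro x
        rw [step_single, step_single, ← Pi.mul_apply, ← Set.inter_indicator_one, Set.Ico_inter_Ico,
          max_self, NNReal.coe_min]
      simp_rw [h]
      rw [integral_indicator_one measurableSet_Ico, minForm_single, Measure.real,
        Measure.restrict_apply measurableSet_Ico, Set.inter_eq_left.2 Set.Ico_subset_Ici_self,
        Real.volume_Ico, sub_zero, ENNReal.toReal_ofReal (NNReal.coe_nonneg _)]

theorem minForm_interval_eq_zero {a b c d : ℝ≥0} (hab : a ≤ b) (hcd : c ≤ d)
    (h : Disjoint (Set.Ico a b) (Set.Ico c d)) : minForm (interval a b) (interval c d) = 0 := by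
  rw [← integral_step_mul_step, step_interval hab, step_interval hcd]
  have hz : ∀ x : ℝ, (Set.Ico (a : ℝ) b).indicator (1 : ℝ → ℝ) x *
      (Set.Ico (c : ℝ) d).indicator (1 : ℝ → ℝ) x = 0 := by
    intro x
    by_contra hx
    have hx1 : x ∈ Set.Ico (a : ℝ) b := by
      by_contra h'; simp [Set.indicator_of_notMem h'] at hx
    have hx2 : x ∈ Set.Ico (c : ℝ) d := by
      by_contra h'; simp [Set.indicator_of_notMem h'] at hx
    lift x to ℝ≥0 using a.2.trans hx1.1
    exact Set.disjoint_left.1 h (show x ∈ Set.Ico a b from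
      ⟨by exact_mod_cast hx1.1, by exact_mod_cast hx1.2⟩)
      ⟨by exact_mod_cast hx2.1, by exact_mod_cast hx2.2⟩
  simp [hz]

/-- The product function `x ↦ ∏ i, R i (x i)` of a tuple of step functions. For intervals this
is the indicator of a rectangle, which may meet the diagonals. -/
def rectFun {n : ℕ} (R : Fin n → ℝ≥0 →₀ ℝ) (x : Fin n → ℝ) : ℂ := ∏ i, (step (R i) (x i) : ℂ)

theorem measurable_rectFun {n : ℕ} (R : Fin n → ℝ≥0 →₀ ℝ) : Measurable (rectFun R) :=
  Finset.measurable_prod _ fun i _ =>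
    Complex.measurable_ofReal.comp ((measurable_step (R i)).comp (measurable_pi_apply i))

theorem memLp_rectFun {n : ℕ} (R : Fin n → ℝ≥0 →₀ ℝ) : MemLp (rectFun R) 2 (leb n) := by
  rw [memLp_two_iff_integrable_sq_norm (measurable_rectFun R).aestronglyMeasurable]
  have := Integrable.fintype_prod (𝕜 := ℝ)
    (μ := fun _ : Fin n => (volume : Measure ℝ).restrict (Set.Ici 0))
    fun i => integrable_step_mul_step (R i) (R i)
  refine this.congr (Filter.Eventually.of_forall fun x => ?_)
  simp [rectFun, norm_prod, sq, ← Finset.prod_mul_distrib]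

/-- The class of `rectFun R` in `L²(ℝ₊ⁿ)`. -/
def rect {n : ℕ} (R : Fin n → ℝ≥0 →₀ ℝ) : L2 n := (memLp_rectFun R).toLp _

theorem coeFn_rect {n : ℕ} (R : Fin n → ℝ≥0 →₀ ℝ) : rect R =ᵐ[leb n] rectFun R :=
  MemLp.coeFn_toLp _

theorem integral_rectFun_mul {n : ℕ} (R Q : Fin n → ℝ≥0 →₀ ℝ) :
    ∫ x, rectFun R x * rectFun Q x ∂leb n = ((∏ i, minForm (R i) (Q i) : ℝ) : ℂ) := by
  have h : ∀ x, rectFun R x * rectFun Q x =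
      ((∏ i, step (R i) (x i) * step (Q i) (x i) : ℝ) : ℂ) := fun x => by
    simp [rectFun, Finset.prod_mul_distrib]
  simp_rw [h]
  rw [integral_complex_ofReal, integral_fintype_prod_eq_prod
    (μ := fun _ : Fin n => (volume : Measure ℝ).restrict (Set.Ici 0))
    (f := fun i x => step (R i) x * step (Q i) x)]
  simp_rw [integral_step_mul_step]

theorem inner_rect {n : ℕ} (R Q : Fin n → ℝ≥0 →₀ ℝ) :
    inner ℂ (rect R) (rect Q) = ((∏ i, minForm (R i) (Q i) : ℝ) : ℂ) := by
  rw [L2.inner_def, ← integral_rectFun_mul]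
  refine integral_congr_ae ?_
  filter_upwards [coeFn_rect R, coeFn_rect Q] with x h1 h2
  rw [h1, h2]
  simp [rectFun, mul_comm]

theorem Box.indicator_eq_rect {n : ℕ} (b : Box n) :
    b.indicator = rect fun i => interval (b.lo i) (b.hi i) := by
  classical
  apply Lp.ext
  filter_upwards [coeFn_rect fun i => interval (b.lo i) (b.hi i),
    indicatorConstLp_coeFn (p := 2) (hs := b.measurableSet) (hμs := b.measure_ne_top)
      (c := (1 : ℂ))] with x h1 h2
  rw [h1, Box.indicator, h2]
  simp only [rectFun, step_interval (b.le _), Set.indicator_apply, Pi.one_apply, Box.toSet,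
    Set.mem_univ_pi]
  split_ifs with h
  · simp only [if_pos (h _), Complex.ofReal_one, Finset.prod_const_one]
  · push Not at h
    obtain ⟨i, hi⟩ := h
    rw [Finset.prod_eq_zero (Finset.mem_univ i)]
    simp [hi]

end StepFunctions

/-! ### Off-diagonal boxes span a dense subspace -/

section Density

/-- A square-integrable function vanishes almost everywhere if countably many sets of finite measure
cover the space up to a null set, and its integral vanishes over each of them and over its
intersections with the members of a generating `π`-system. -/
theorem ae_eq_zero_of_setIntegral_inter_eq_zero {α ι : Type*} [Countable ι] {mα : MeasurableSpace α}
    {μ : Measure α} {C : Set (Set α)} (hC : mα = MeasurableSpace.generateFrom C)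
    (hpi : IsPiSystem C) (D : ι → Set α) (hDm : ∀ i, MeasurableSet (D i)) (hD : ∀ i, μ (D i) ≠ ⊤)
    (hcov : ∀ᵐ x ∂μ, ∃ i, x ∈ D i) {f : α → ℂ} (hf : MemLp f 2 μ)
    (h : ∀ i, ∀ c ∈ C, ∫ x in c ∩ D i, f x ∂μ = 0) (huniv : ∀ i, ∫ x in D i, f x ∂μ = 0) :
    f =ᵐ[μ] 0 := by
  have hi : ∀ i, ∀ᵐ x ∂μ, x ∈ D i → f x = 0 := by
    intro i
    rw [← ae_restrict_iff' (hDm i)]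
    have : IsFiniteMeasure (μ.restrict (D i)) := ⟨by simpa using (hD i).lt_top⟩
    have hint : Integrable f (μ.restrict (D i)) := (hf.restrict (D i)).integrable (by norm_num)
    have key : ∀ s, MeasurableSet s → ∫ x in s, f x ∂μ.restrict (D i) = 0 := by
      intro s hs
      induction s, hs using MeasurableSpace.induction_on_inter hC hpi with
      | empty => simp
      | basic c hc =>
        have hcm : MeasurableSet c := by
          rw [hC]
          exact MeasurableSpace.measurableSet_generateFrom hc
        rw [Measure.restrict_restrict hcm, h i c hc]
      | compl t ht ih =>
        have := integral_add_compl ht hint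
        rw [ih, zero_add, huniv i] at this
        exact this
      | iUnion t htd htm ih =>
        rw [integral_iUnion htm htd hint.integrableOn]
        simp [ih]
    exact hint.ae_eq_zero_of_forall_setIntegral_eq_zero fun s hs _ => key s hs
  filter_upwards [hcov, ae_all_iff.2 hi] with x ⟨i, hx⟩ h'
  exact h' i hx

theorem denseRange_linearCombination {E ι : Type*} [NormedAddCommGroup E] [InnerProductSpace ℂ E]
    [CompleteSpace E] (a : ι → E) (h : ∀ f : E, (∀ i, inner ℂ (a i) f = 0) → f = 0) :
    DenseRange (Finsupp.linearCombination ℂ a) := by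
  have : (LinearMap.range (Finsupp.linearCombination ℂ a)).topologicalClosure = ⊤ := by
    rw [Submodule.topologicalClosure_eq_top_iff, Submodule.eq_bot_iff]
    intro f hf
    refine h f fun i => ?_
    rw [Submodule.mem_orthogonal] at hf
    exact hf _ ⟨Finsupp.single i 1, by simp⟩
  rw [← Submodule.dense_iff_topologicalClosure_eq_top] at this
  rwa [LinearMap.coe_range] at this

theorem ae_leb_nonneg (n : ℕ) : ∀ᵐ x ∂leb n, ∀ i, 0 ≤ x i := by
  rw [ae_all_iff]
  intro i
  have h0 : ∀ᵐ y ∂(volume : Measure ℝ).restrict (Set.Ici 0), (0 : ℝ) ≤ y :=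
    ae_restrict_mem measurableSet_Ici
  exact (Measure.quasiMeasurePreserving_eval
    (fun _ : Fin n => (volume : Measure ℝ).restrict (Set.Ici 0)) i).ae h0

theorem ae_leb_injective (n : ℕ) : ∀ᵐ x ∂leb n, ∀ i j, i ≠ j → x i ≠ x j := by
  simp only [ae_all_iff]
  intro i j hij
  have hac : leb n ≪ volume := by
    rw [leb, ← Measure.restrict_pi_pi]
    exact Measure.absolutelyContinuous_of_le Measure.restrict_le_self
  apply hac.ae_le
  let p : Submodule ℝ (Fin n → ℝ) :=
    LinearMap.ker (LinearMap.proj (R := ℝ) (φ := fun _ : Fin n => ℝ) i - LinearMap.proj j)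
  have hp : p ≠ ⊤ := by
    intro h
    have : (Pi.single i 1 : Fin n → ℝ) ∈ p := h ▸ Submodule.mem_top
    simp [p, hij.symm] at this
  have := Measure.addHaar_submodule (volume : Measure (Fin n → ℝ)) p hp
  refine mem_ae_iff.2 ?_
  convert this using 2
  ext x
  simp [p, sub_eq_zero]

/-- The cell `∏ i, [j i / (k + 1), (j i + 1) / (k + 1))` of the grid of mesh `1 / (k + 1)`. It meets
no diagonal because `j` is injective. -/
def gridBox {n : ℕ} (k : ℕ) (j : Fin n ↪ ℕ) : Box n where
  lo i := j i / (k + 1)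
  hi i := (j i + 1) / (k + 1)
  le i := by gcongr; simp
  disjoint i l hil := by
    rw [Set.disjoint_left]
    rintro x ⟨h1, h2⟩ ⟨h3, h4⟩
    have hk : (0 : ℝ≥0) < k + 1 := by positivity
    rw [div_le_iff₀ hk] at h1 h3
    rw [lt_div_iff₀ hk] at h2 h4
    have h5 : (j i : ℝ≥0) < j l + 1 := h1.trans_lt h4
    have h6 : (j l : ℝ≥0) < j i + 1 := h3.trans_lt h2
    norm_cast at h5 h6
    exact hil (j.injective (by omega))

theorem exists_mem_gridBox {n : ℕ} {x : Fin n → ℝ} (h0 : ∀ i, 0 ≤ x i)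
    (hx : ∀ i j, i ≠ j → x i ≠ x j) : ∃ k : ℕ, ∃ j : Fin n ↪ ℕ, x ∈ (gridBox k j).toSet := by
  have hk : ∃ k : ℕ, ∀ i j, i ≠ j → 1 ≤ |x i - x j| * (k + 1) := by
    have : ∀ᶠ k : ℕ in Filter.atTop, ∀ i j, i ≠ j → 1 ≤ |x i - x j| * (k + 1) := by
      simp only [Filter.eventually_all]
      intro i j hij
      have hpos : 0 < |x i - x j| := abs_pos.2 (sub_ne_zero.2 (hx i j hij))
      obtain ⟨N, hN⟩ := exists_nat_ge (1 / |x i - x j|)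
      filter_upwards [Filter.eventually_ge_atTop N] with k hk
      have h1 : (N : ℝ) ≤ k := by exact_mod_cast hk
      rw [div_le_iff₀ hpos] at hN
      nlinarith
    exact this.exists
  obtain ⟨k, hk⟩ := hk
  have hk0 : (0 : ℝ) < k + 1 := by positivity
  have hfl : ∀ i, (⌊x i * (k + 1)⌋₊ : ℝ) ≤ x i * (k + 1) ∧ x i * (k + 1) < ⌊x i * (k + 1)⌋₊ + 1 :=
    fun i => ⟨Nat.floor_le (mul_nonneg (h0 i) hk0.le), Nat.lt_floor_add_one _⟩
  refine ⟨k, ⟨fun i => ⌊x i * (k + 1)⌋₊, fun i j hij => ?_⟩, ?_⟩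
  · by_contra hne
    have h1 := hk i j hne
    have h2 := hfl i
    have h3 := hfl j
    simp only at hij
    rw [hij] at h2
    rw [← abs_of_pos hk0, ← abs_mul] at h1
    have : |(x i - x j) * (k + 1)| < 1 := by rw [abs_lt]; constructor <;> linarith
    linarith
  · intro i _
    simp only [gridBox, Set.mem_Ico, NNReal.coe_div, NNReal.coe_add,
      NNReal.coe_natCast, NNReal.coe_one]
    rw [div_le_iff₀ hk0, lt_div_iff₀ hk0]
    exact hfl i

theorem exists_box_inter {n : ℕ} (b : Box n) (l u : Fin n → ℝ) :
    ∃ b' : Box n, b'.toSet = (Set.univ.pi fun i => Set.Ico (l i) (u i)) ∩ b.toSet := by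
  let lo : Fin n → ℝ≥0 := fun i => max (b.lo i) (l i).toNNReal
  let hi : Fin n → ℝ≥0 := fun i => max (lo i) (min (b.hi i) (u i).toNNReal)
  have hsub : ∀ i, Set.Ico (lo i) (hi i) ⊆ Set.Ico (b.lo i) (b.hi i) := by
    rintro i x ⟨h1, h2⟩
    refine ⟨(le_max_left _ _).trans h1, ?_⟩
    rcases lt_max_iff.1 h2 with h | h
    · exact absurd h1 (not_le.2 h)
    · exact h.trans_le (min_le_left _ _)
  refine ⟨⟨lo, hi, fun i => le_max_left _ _, fun i j hij =>
    (b.disjoint i j hij).mono (hsub i) (hsub j)⟩, ?_⟩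
  rw [Box.toSet, Box.toSet, ← Set.pi_inter_distrib]
  refine congrArg _ (funext fun i => ?_)
  have hb : (0 : ℝ) ≤ b.lo i := (b.lo i).2
  ext x
  simp only [hi, lo, Set.mem_Ico, NNReal.coe_max, NNReal.coe_min, Real.coe_toNNReal',
    Set.mem_inter_iff, max_le_iff, lt_max_iff, lt_min_iff]
  constructor
  · rintro ⟨⟨h1, h2, h3⟩, (h4 | h4) | h4⟩
    · linarith
    · rcases h4 with h | h <;> linarith
    · rcases h4 with ⟨h5, h6 | h6⟩
      · exact ⟨⟨h2, h6⟩, h1, h5⟩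
      · linarith
  · rintro ⟨⟨h1, h2⟩, h3, h4⟩
    exact ⟨⟨h3, h1, hb.trans h3⟩, Or.inr ⟨h4, Or.inl h2⟩⟩

theorem denseRange_box (n : ℕ) :
    DenseRange (Finsupp.linearCombination ℂ fun b : Box n => b.indicator) := by
  refine denseRange_linearCombination _ fun f hf => ?_
  have hb : ∀ b : Box n, ∫ x in b.toSet, f x ∂leb n = 0 := fun b => by
    rw [← L2.inner_indicatorConstLp_one (𝕜 := ℂ) b.measurableSet b.measure_ne_top f]
    exact hf b
  refine (Lp.eq_zero_iff_ae_eq_zero).2 ?_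
  have : Countable (Fin n ↪ ℕ) := DFunLike.coe_injective.countable
  refine ae_eq_zero_of_setIntegral_inter_eq_zero (ι := ℕ × (Fin n ↪ ℕ))
    (C := Set.univ.pi '' Set.univ.pi fun _ : Fin n => {S : Set ℝ | ∃ l u, l < u ∧ Set.Ico l u = S})
    ?_ ?_ (fun q => (gridBox q.1 q.2).toSet) (fun _ => Box.measurableSet _)
    (fun _ => Box.measure_ne_top _) ?_ (Lp.memLp f) ?_ (fun _ => hb _)
  · refine (generateFrom_eq_pi (fun _ => ?_) fun _ => ?_).symm
    · exact (BorelSpace.measurable_eq.trans (borel_eq_generateFrom_Ico ℝ)).symm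
    · refine ⟨fun k : ℕ => Set.Ico (-(k + 1 : ℝ)) (k + 1), fun k => ⟨_, _, by linarith, rfl⟩, ?_⟩
      refine Set.eq_univ_of_forall fun x => ?_
      obtain ⟨k, hk⟩ := exists_nat_gt |x|
      have := abs_lt.1 hk
      exact Set.mem_iUnion.2 ⟨k, by linarith, by linarith⟩
  · exact IsPiSystem.pi fun _ => isPiSystem_Ico id id
  · filter_upwards [ae_leb_nonneg n, ae_leb_injective n] with x h1 h2
    obtain ⟨k, j, h⟩ := exists_mem_gridBox h1 h2
    exact ⟨(k, j), h⟩
  · rintro q _ ⟨s, hs, rfl⟩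
    simp only [Set.mem_pi, Set.mem_univ, forall_const, Set.mem_ofPred_eq] at hs
    choose l u _ hs using hs
    obtain ⟨b', hb'⟩ := exists_box_inter (gridBox q.1 q.2) l u
    simp_rw [hs] at hb'
    rw [← hb']
    exact hb b'

end Density

/-! ### Elementary tensors -/

section Tensor

variable {n m : ℕ}

theorem coeFn_tensorL2 (g : L2 n) (h : L2 m) :
    tensorL2 g h =ᵐ[(leb n).prod (leb m)] fun z => g z.1 * h z.2 :=
  MemLp.coeFn_toLp _

theorem inner_tensorL2 (g g' : L2 n) (h h' : L2 m) :
    inner ℂ (tensorL2 g h) (tensorL2 g' h') = inner ℂ g g' * inner ℂ h h' := by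
  rw [L2.inner_def, L2.inner_def, L2.inner_def, ← integral_prod_mul]
  refine integral_congr_ae ?_
  filter_upwards [coeFn_tensorL2 g h, coeFn_tensorL2 g' h'] with z h1 h2
  rw [h1, h2]
  simp
  ring

/-- The tensor product of functions as a bilinear map. -/
def tensorL2ₗ (n m : ℕ) : L2 n →ₗ[ℂ] L2 m →ₗ[ℂ] L2Tensor n m :=
  LinearMap.mk₂ ℂ tensorL2
    (fun g g' h => Lp.ext (by
      filter_upwards [coeFn_tensorL2 (g + g') h, coeFn_tensorL2 g h, coeFn_tensorL2 g' h,
        Lp.coeFn_add (tensorL2 g h) (tensorL2 g' h),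
        Measure.quasiMeasurePreserving_fst.ae_eq_comp (Lp.coeFn_add g g')] with z h1 h2 h3 h4 h5
      simp only [Function.comp] at h5
      rw [h1, h4, h5, Pi.add_apply, Pi.add_apply, h2, h3, add_mul]))
    (fun c g h => Lp.ext (by
      filter_upwards [coeFn_tensorL2 (c • g) h, coeFn_tensorL2 g h,
        Lp.coeFn_smul c (tensorL2 g h),
        Measure.quasiMeasurePreserving_fst.ae_eq_comp (Lp.coeFn_smul c g)] with z h1 h2 h4 h5
      simp only [Function.comp] at h5
      rw [h1, h4, h5, Pi.smul_apply, Pi.smul_apply, h2, smul_mul_assoc]))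
    (fun g h h' => Lp.ext (by
      filter_upwards [coeFn_tensorL2 g (h + h'), coeFn_tensorL2 g h, coeFn_tensorL2 g h',
        Lp.coeFn_add (tensorL2 g h) (tensorL2 g h'),
        Measure.quasiMeasurePreserving_snd.ae_eq_comp (Lp.coeFn_add h h')] with z h1 h2 h3 h4 h5
      simp only [Function.comp] at h5
      rw [h1, h4, h5, Pi.add_apply, Pi.add_apply, h2, h3, mul_add]))
    (fun c g h => Lp.ext (by
      filter_upwards [coeFn_tensorL2 g (c • h), coeFn_tensorL2 g h,
        Lp.coeFn_smul c (tensorL2 g h),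
        Measure.quasiMeasurePreserving_snd.ae_eq_comp (Lp.coeFn_smul c h)] with z h1 h2 h4 h5
      simp only [Function.comp] at h5
      rw [h1, h4, h5, Pi.smul_apply, Pi.smul_apply, h2, mul_smul_comm]))

theorem norm_tensorL2 (g : L2 n) (h : L2 m) : ‖tensorL2 g h‖ = ‖g‖ * ‖h‖ := by
  have h1 := inner_tensorL2 g g h h
  rw [inner_self_eq_norm_sq_to_K, inner_self_eq_norm_sq_to_K, inner_self_eq_norm_sq_to_K,
    ← mul_pow] at h1
  have h2 : ‖tensorL2 g h‖ ^ 2 = (‖g‖ * ‖h‖) ^ 2 := by exact_mod_cast h1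
  exact (pow_left_inj₀ (norm_nonneg _) (by positivity) two_ne_zero).1 h2

/-- The tensor product of functions as a continuous bilinear map. -/
def tensorL2L (n m : ℕ) : L2 n →L[ℂ] L2 m →L[ℂ] L2Tensor n m :=
  (tensorL2ₗ n m).mkContinuous₂ 1 fun g h => by
    simpa [tensorL2ₗ] using (norm_tensorL2 g h).le

@[simp] theorem tensorL2L_apply (g : L2 n) (h : L2 m) : tensorL2L n m g h = tensorL2 g h := rfl

theorem tensorL2_indicatorConstLp {s : Set (Fin n → ℝ)} {t : Set (Fin m → ℝ)} (hs : MeasurableSet s)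
    (ht : MeasurableSet t) (hs' : leb n s ≠ ⊤) (ht' : leb m t ≠ ⊤)
    (hst : (leb n).prod (leb m) (s ×ˢ t) ≠ ⊤) :
    tensorL2 (indicatorConstLp 2 hs hs' 1) (indicatorConstLp 2 ht ht' 1) =
      indicatorConstLp 2 (hs.prod ht) hst (1 : ℂ) := by
  classical
  apply Lp.ext
  filter_upwards [coeFn_tensorL2 (indicatorConstLp 2 hs hs' 1) (indicatorConstLp 2 ht ht' 1),
    indicatorConstLp_coeFn (p := 2) (hs := hs.prod ht) (hμs := hst) (c := (1 : ℂ)),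
    Measure.quasiMeasurePreserving_fst.ae_eq_comp
      (indicatorConstLp_coeFn (p := 2) (hs := hs) (hμs := hs') (c := (1 : ℂ))),
    Measure.quasiMeasurePreserving_snd.ae_eq_comp
      (indicatorConstLp_coeFn (p := 2) (hs := ht) (hμs := ht') (c := (1 : ℂ)))] with z h1 h2 h3 h4
  simp only [Function.comp] at h3 h4
  rw [h1, h2, h3, h4]
  simp only [Set.indicator_apply, Set.mem_prod]
  split_ifs <;> simp_all

theorem denseRange_tensorL2 (n m : ℕ) :
    DenseRange (Finsupp.linearCombination ℂ fun z : L2 n × L2 m => tensorL2 z.1 z.2) := by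
  refine denseRange_linearCombination _ fun f hf => ?_
  have hb : ∀ s t, MeasurableSet s → MeasurableSet t → leb n s ≠ ⊤ → leb m t ≠ ⊤ →
      ∫ x in s ×ˢ t, f x ∂(leb n).prod (leb m) = 0 := fun s t hs ht hs' ht' => by
    have hst : (leb n).prod (leb m) (s ×ˢ t) ≠ ⊤ := by
      rw [Measure.prod_prod]; exact ENNReal.mul_ne_top hs' ht'
    rw [← L2.inner_indicatorConstLp_one (𝕜 := ℂ) (hs.prod ht) hst f,
      ← tensorL2_indicatorConstLp hs ht hs' ht' hst]
    exact hf (_, _)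
  refine (Lp.eq_zero_iff_ae_eq_zero).2 ?_
  refine ae_eq_zero_of_setIntegral_inter_eq_zero (ι := ℕ)
    generateFrom_prod.symm isPiSystem_prod
    (fun k => spanningSets (leb n) k ×ˢ spanningSets (leb m) k)
    (fun k => (measurableSet_spanningSets _ k).prod (measurableSet_spanningSets _ k))
    (fun k => ?_) (Filter.Eventually.of_forall fun x => ?_) (Lp.memLp f) ?_
    (fun k => hb _ _ (measurableSet_spanningSets _ k) (measurableSet_spanningSets _ k)
      (measure_spanningSets_lt_top _ k).ne (measure_spanningSets_lt_top _ k).ne)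
  · rw [Measure.prod_prod]
    exact ENNReal.mul_ne_top (measure_spanningSets_lt_top _ k).ne
      (measure_spanningSets_lt_top _ k).ne
  · refine ⟨max (spanningSetsIndex (leb n) x.1) (spanningSetsIndex (leb m) x.2), ?_, ?_⟩
    · exact monotone_spanningSets _ (le_max_left _ _) (mem_spanningSetsIndex _ _)
    · exact monotone_spanningSets _ (le_max_right _ _) (mem_spanningSetsIndex _ _)
  · rintro k _ ⟨s, hs, t, ht, rfl⟩
    rw [Set.mem_ofPred_eq] at hs ht
    rw [Set.prod_inter_prod]
    exact hb _ _ (MeasurableSet.inter hs (measurableSet_spanningSets _ k))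
      (MeasurableSet.inter ht (measurableSet_spanningSets _ k))
      (measure_ne_top_of_subset Set.inter_subset_right (measure_spanningSets_lt_top _ k).ne)
      (measure_ne_top_of_subset Set.inter_subset_right (measure_spanningSets_lt_top _ k).ne)

theorem denseRange_tensor_rect (n m : ℕ) :
    DenseRange (Finsupp.linearCombination ℂ
      fun z : (Fin n → ℝ≥0 →₀ ℝ) × (Fin m → ℝ≥0 →₀ ℝ) => tensorL2 (rect z.1) (rect z.2)) := by
  refine denseRange_linearCombination _ fun f hf => ?_
  have h1 : ∀ (b : Box n) (h : L2 m), inner ℂ f (tensorL2 b.indicator h) = 0 := by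
    intro b h
    refine isClosed_property (p := fun h => inner ℂ f (tensorL2 b.indicator h) = 0)
      (denseRange_box m) (isClosed_eq ?_ continuous_const) (fun c => ?_) h
    · exact continuous_const.inner (tensorL2L n m b.indicator).continuous
    · rw [← tensorL2L_apply, Finsupp.linearCombination_apply, map_finsuppSum, Finsupp.inner_sum]
      refine Finset.sum_eq_zero fun b' _ => ?_
      beta_reduce
      rw [map_smul, tensorL2L_apply, inner_smul_right, b.indicator_eq_rect, b'.indicator_eq_rect,
        inner_eq_zero_symm.1 (hf (_, _)), mul_zero]
  have h2 : ∀ (g : L2 n) (h : L2 m), inner ℂ f (tensorL2 g h) = 0 := by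
    intro g h
    refine isClosed_property (p := fun g => inner ℂ f (tensorL2 g h) = 0)
      (denseRange_box n) (isClosed_eq ?_ continuous_const) (fun c => ?_) g
    · exact continuous_const.inner ((tensorL2L n m).flip h).continuous
    · rw [← tensorL2L_apply, Finsupp.linearCombination_apply, ← ContinuousLinearMap.flip_apply,
        map_finsuppSum, Finsupp.inner_sum]
      refine Finset.sum_eq_zero fun b _ => ?_
      beta_reduce
      rw [map_smul, ContinuousLinearMap.flip_apply, tensorL2L_apply, inner_smul_right, h1, mul_zero]
  have h3 : ∀ x, inner ℂ f x = 0 := by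
    intro x
    refine isClosed_property (p := fun x => inner ℂ f x = 0) (denseRange_tensorL2 n m)
      (isClosed_eq (by fun_prop) continuous_const) (fun c => ?_) x
    rw [Finsupp.linearCombination_apply, Finsupp.inner_sum]
    exact Finset.sum_eq_zero fun z _ => by simp [inner_smul_right, h2]
  exact inner_self_eq_zero.1 (h3 f)

end Tensor

/-! ### Wigner integrals of rectangle functions -/

section Integral

variable {A : Type u} [CStarAlgebra A] [PartialOrder A] [StarOrderedRing A] {φ : A →ₚ[ℂ] ℂ}

theorem inner_toL2 (a b : A) : inner ℂ (toL2 φ a) (toL2 φ b) = φ (star a * b) := by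
  simp only [toL2, LinearMap.comp_apply, LinearEquiv.coe_coe, ContinuousLinearMap.coe_coe,
    Completion.coe_toComplL, Completion.inner_coe]
  rfl

/-- The Wick word of a tuple of step functions, with the Brownian motion `S` in place of the
variables. -/
def wickTuple (S : ℝ≥0 → A) {n : ℕ} (R : Fin n → ℝ≥0 →₀ ℝ) : A :=
  wick minForm (brownianMap S) (List.ofFn R)

theorem wick_of_isChain {V A : Type*} [AddCommGroup V] [Module ℝ V] [Ring A] [Algebra ℝ A]
    {B : V →ₗ[ℝ] V →ₗ[ℝ] ℝ} {X : V →ₗ[ℝ] A} (l : List V) (h : l.IsChain fun x y => B x y = 0) :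
    wick B X l = (l.map X).prod := by
  induction l using list_induction_two with
  | h0 => simp
  | h1 x => simp
  | h2 x y l ih1 ih2 =>
    rw [wick_cons_cons, ih2 h.tail, (List.isChain_cons_cons.1 h).1]
    simp

theorem increments_eq_wickTuple (S : ℝ≥0 → A) {n : ℕ} (b : Box n) :
    increments S b = wickTuple S fun i => interval (b.lo i) (b.hi i) := by
  rw [increments, wickTuple, wick_of_isChain, List.map_ofFn]
  · congr 2
    ext i
    simp [interval]
  · rw [List.isChain_iff_getElem]
    intro i hi
    simp only [List.length_ofFn] at hi
    simp only [List.getElem_ofFn]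
    exact minForm_interval_eq_zero (b.le _) (b.le _) (b.disjoint _ _ (by simp))

variable [WStarAlgebra A] {F : ℝ≥0 → StarSubalgebra ℂ A} {S : ℝ≥0 → A}

theorem inner_wickTuple (hφ : IsTracialState φ) (hS : IsFreeBrownianMotion φ F S) {n : ℕ}
    (R Q : Fin n → ℝ≥0 →₀ ℝ) :
    inner ℂ (toL2 φ (wickTuple S R)) (toL2 φ (wickTuple S Q)) =
      ((∏ i, minForm (R i) (Q i) : ℝ) : ℂ) := by
  rw [inner_toL2, wickTuple, wickTuple, star_wick minForm_comm (star_brownianMap hS.selfAdjoint)]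
  have := map_wick_mul_wick (B := minForm) (X := brownianMap S)
    (φ.toLinearMap.restrictScalars ℝ) hφ.unital
    (fun l hl => map_wick_eq_zero hS l hl) (List.ofFn R) (List.ofFn Q) (by simp)
  refine this.trans ?_
  rw [← List.prod_ofFn]
  congr 2
  refine List.ext_getElem (by simp) fun i h1 h2 => by simp

/-- The Wigner integral of any rectangle function, on or off the diagonals, is the Wick word of its
sides. On off-diagonal boxes this is the definition; in general it holds because Wick words and
rectangle functions have the same Gram matrix. -/
theorem wignerIntegral_rect (hφ : IsTracialState φ) (hS : IsFreeBrownianMotion φ F S) {n : ℕ}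
    (R : Fin n → ℝ≥0 →₀ ℝ) : wignerIntegral φ S n (rect R) = toL2 φ (wickTuple S R) := by
  have := extendOfNorm_apply_of_gram (a := fun R : Fin n → ℝ≥0 →₀ ℝ => rect R)
    (b := fun R => toL2 φ (wickTuple S R))
    (σ := fun b : Box n => fun i => interval (b.lo i) (b.hi i))
    (fun R Q => by rw [inner_rect, inner_wickTuple hφ hS])
    (by simpa only [← Box.indicator_eq_rect] using denseRange_box n) R
  simpa only [wignerIntegral, increments_eq_wickTuple, Box.indicator_eq_rect] using this

theorem norm_wignerIntegral (hφ : IsTracialState φ) (hS : IsFreeBrownianMotion φ F S) {n : ℕ}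
    (f : L2 n) : ‖wignerIntegral φ S n f‖ = ‖f‖ := by
  refine norm_extendOfNorm_of_gram (fun b c => ?_) (denseRange_box n) f
  rw [b.indicator_eq_rect, c.indicator_eq_rect, increments_eq_wickTuple, increments_eq_wickTuple,
    inner_rect, inner_wickTuple hφ hS]

theorem inner_wignerIntegral (hφ : IsTracialState φ) (hS : IsFreeBrownianMotion φ F S) {n : ℕ}
    (f g : L2 n) : inner ℂ (wignerIntegral φ S n f) (wignerIntegral φ S n g) = inner ℂ f g :=
  (⟨(wignerIntegral φ S n).toLinearMap, norm_wignerIntegral hφ hS⟩ :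
    L2 n →ₗᵢ[ℂ] φ.GNS).inner_map_map f g

theorem biIntegral_tensorL2 (hφ : IsTracialState φ) (hS : IsFreeBrownianMotion φ F S) {n m : ℕ}
    (g : L2 n) (h : L2 m) :
    biIntegral φ S n m (tensorL2 g h) =
      ((wignerIntegral φ S n g ⊗ₜ[ℂ] wignerIntegral φ S m h : φ.GNS ⊗[ℂ] φ.GNS) : BiL2 φ) :=
  extendOfNorm_apply_of_gram (ι := L2 n × L2 m) (σ := id)
    (a := fun z => tensorL2 z.1 z.2)
    (b := fun z => ((wignerIntegral φ S n z.1 ⊗ₜ[ℂ] wignerIntegral φ S m z.2 : φ.GNS ⊗[ℂ] φ.GNS) :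
      BiL2 φ))
    (fun z w => by
      rw [inner_tensorL2, Completion.inner_coe, TensorProduct.inner_tmul,
        inner_wignerIntegral hφ hS, inner_wignerIntegral hφ hS])
    (denseRange_tensorL2 n m) (g, h)

theorem biIntegral_tensor_rect (hφ : IsTracialState φ) (hS : IsFreeBrownianMotion φ F S) {n m : ℕ}
    (R : Fin n → ℝ≥0 →₀ ℝ) (Q : Fin m → ℝ≥0 →₀ ℝ) :
    biIntegral φ S n m (tensorL2 (rect R) (rect Q)) =
      toBiL2 φ (wickTuple S R ⊗ₜ[ℂ] wickTuple S Q) := by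
  rw [biIntegral_tensorL2 hφ hS, wignerIntegral_rect hφ hS, wignerIntegral_rect hφ hS]
  rfl

end Integral

/-! ### Composition of square-integrable kernels -/

section Kernel

open scoped ENNReal

variable {α β γ : Type*} [MeasurableSpace α] [MeasurableSpace β] [MeasurableSpace γ]
  {μ : Measure α} {ν : Measure β} {ω : Measure γ} [SigmaFinite ω]

/-- The kernel `(a, b) ↦ ∫ F(a, w) G(b, w) dω(w)`. -/
def kernelComp (ω : Measure γ) (F : α × γ → ℂ) (G : β × γ → ℂ) (z : α × β) : ℂ :=
  ∫ w, F (z.1, w) * G (z.2, w) ∂ω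

theorem kernelComp_congr {F F' : α × γ → ℂ} {G G' : β × γ → ℂ} (hF : F =ᵐ[μ.prod ω] F')
    (hG : G =ᵐ[ν.prod ω] G') : kernelComp ω F G =ᵐ[μ.prod ν] kernelComp ω F' G' := by
  filter_upwards [Measure.quasiMeasurePreserving_fst.ae (Measure.ae_ae_of_ae_prod hF),
    Measure.quasiMeasurePreserving_snd.ae (Measure.ae_ae_of_ae_prod hG)] with z h1 h2
  refine integral_congr_ae ?_
  filter_upwards [h1, h2] with w h3 h4
  rw [h3, h4]

variable [SigmaFinite μ] [SigmaFinite ν]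

theorem memLp_section_ae {F : α × γ → ℂ} (hF : MemLp F 2 (μ.prod ω)) :
    ∀ᵐ a ∂μ, MemLp (fun w => F (a, w)) 2 ω := by
  have h1 := (memLp_two_iff_integrable_sq_norm hF.1).1 hF
  filter_upwards [hF.1.prodMk_left, h1.prod_right_ae] with a h2 h3
  exact (memLp_two_iff_integrable_sq_norm h2).2 h3

theorem kernelComp_integrable_ae {F : α × γ → ℂ} {G : β × γ → ℂ} (hF : MemLp F 2 (μ.prod ω))
    (hG : MemLp G 2 (ν.prod ω)) :
    ∀ᵐ z ∂μ.prod ν, Integrable (fun w => F (z.1, w) * G (z.2, w)) ω := by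
  filter_upwards [Measure.quasiMeasurePreserving_fst.ae (memLp_section_ae hF),
    Measure.quasiMeasurePreserving_snd.ae (memLp_section_ae hG)] with z h1 h2
  exact h1.integrable_mul h2

theorem aestronglyMeasurable_kernelComp {F : α × γ → ℂ} {G : β × γ → ℂ}
    (hF : AEStronglyMeasurable F (μ.prod ω)) (hG : AEStronglyMeasurable G (ν.prod ω)) :
    AEStronglyMeasurable (kernelComp ω F G) (μ.prod ν) := by
  refine ⟨kernelComp ω (hF.mk F) (hG.mk G), ?_, kernelComp_congr hF.ae_eq_mk hG.ae_eq_mk⟩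
  refine StronglyMeasurable.integral_prod_right' (f := fun q : (α × β) × γ =>
    hF.mk F (q.1.1, q.2) * hG.mk G (q.1.2, q.2)) ?_
  exact (hF.stronglyMeasurable_mk.comp_measurable (by fun_prop)).mul
    (hG.stronglyMeasurable_mk.comp_measurable (by fun_prop))

theorem eLpNorm_two_sq {X : Type*} [MeasurableSpace X] {ρ : Measure X} (f : X → ℂ) :
    eLpNorm f 2 ρ ^ 2 = ∫⁻ x, ‖f x‖ₑ ^ 2 ∂ρ := by
  rw [eLpNorm_eq_lintegral_rpow_enorm_toReal (by simp) (by simp), ← ENNReal.rpow_natCast,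
    ← ENNReal.rpow_mul]
  simp

/-- The Cauchy–Schwarz inequality in the contracted variable. -/
theorem eLpNorm_kernelComp_le {F : α × γ → ℂ} {G : β × γ → ℂ}
    (hF : AEStronglyMeasurable F (μ.prod ω)) (hG : AEStronglyMeasurable G (ν.prod ω)) :
    eLpNorm (kernelComp ω F G) 2 (μ.prod ν) ≤
      eLpNorm F 2 (μ.prod ω) * eLpNorm G 2 (ν.prod ω) := by
  wlog h : Measurable F ∧ Measurable G generalizing F G
  · rw [eLpNorm_congr_ae (kernelComp_congr hF.ae_eq_mk hG.ae_eq_mk),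
      eLpNorm_congr_ae hF.ae_eq_mk, eLpNorm_congr_ae hG.ae_eq_mk]
    exact this hF.stronglyMeasurable_mk.aestronglyMeasurable
      hG.stronglyMeasurable_mk.aestronglyMeasurable
      ⟨hF.stronglyMeasurable_mk.measurable, hG.stronglyMeasurable_mk.measurable⟩
  obtain ⟨hF', hG'⟩ := h
  have hF2 : Measurable fun x => ‖F x‖ₑ ^ 2 := by fun_prop
  have hG2 : Measurable fun x => ‖G x‖ₑ ^ 2 := by fun_prop
  rw [← ENNReal.pow_le_pow_left_iff two_ne_zero, mul_pow, eLpNorm_two_sq, eLpNorm_two_sq,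
    eLpNorm_two_sq, lintegral_prod _ hF2.aemeasurable, lintegral_prod _ hG2.aemeasurable,
    ← lintegral_prod_mul hF2.lintegral_prod_right'.aemeasurable
      hG2.lintegral_prod_right'.aemeasurable]
  refine lintegral_mono fun z => ?_
  have h1 : ‖kernelComp ω F G z‖ₑ ≤ ∫⁻ w, ‖F (z.1, w)‖ₑ * ‖G (z.2, w)‖ₑ ∂ω := by
    refine (enorm_integral_le_lintegral_enorm _).trans_eq ?_
    simp_rw [enorm_mul]
  have h2 := ENNReal.lintegral_mul_le_Lp_mul_Lq ω Real.HolderConjugate.two_two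
    (f := fun w => ‖F (z.1, w)‖ₑ) (g := fun w => ‖G (z.2, w)‖ₑ)
    (by fun_prop) (by fun_prop)
  have h3 := pow_le_pow_left₀ (zero_le) (h1.trans h2) 2
  refine h3.trans_eq ?_
  rw [mul_pow, ← ENNReal.rpow_natCast, ← ENNReal.rpow_mul, ← ENNReal.rpow_natCast,
    ← ENNReal.rpow_mul]
  simp

theorem memLp_kernelComp {F : α × γ → ℂ} {G : β × γ → ℂ} (hF : MemLp F 2 (μ.prod ω))
    (hG : MemLp G 2 (ν.prod ω)) : MemLp (kernelComp ω F G) 2 (μ.prod ν) :=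
  ⟨aestronglyMeasurable_kernelComp hF.1 hG.1,
    (eLpNorm_kernelComp_le hF.1 hG.1).trans_lt (ENNReal.mul_lt_top hF.2 hG.2)⟩

variable (μ ν ω) in
/-- Composition of square-integrable kernels as a continuous bilinear map. -/
def kernelCompL : Lp ℂ 2 (μ.prod ω) →L[ℂ] Lp ℂ 2 (ν.prod ω) →L[ℂ] Lp ℂ 2 (μ.prod ν) :=
  (LinearMap.mk₂ ℂ (fun F G => (memLp_kernelComp (Lp.memLp F) (Lp.memLp G)).toLp _)
    (fun F F' G => by
      rw [← MemLp.toLp_add]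
      refine MemLp.toLp_congr _ _ ((kernelComp_congr (Lp.coeFn_add F F')
        (Filter.EventuallyEq.refl _ _)).trans ?_)
      filter_upwards [kernelComp_integrable_ae (Lp.memLp F) (Lp.memLp G),
        kernelComp_integrable_ae (Lp.memLp F') (Lp.memLp G)] with z h1 h2
      simp only [kernelComp, Pi.add_apply, add_mul]
      exact integral_add h1 h2)
    (fun c F G => by
      rw [← MemLp.toLp_const_smul]
      refine MemLp.toLp_congr _ _ ((kernelComp_congr (Lp.coeFn_smul c F)
        (Filter.EventuallyEq.refl _ _)).trans (Filter.Eventually.of_forall fun z => ?_))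
      simp only [kernelComp, Pi.smul_apply, smul_mul_assoc]
      exact integral_smul c _)
    (fun F G G' => by
      rw [← MemLp.toLp_add]
      refine MemLp.toLp_congr _ _ ((kernelComp_congr (Filter.EventuallyEq.refl _ _)
        (Lp.coeFn_add G G')).trans ?_)
      filter_upwards [kernelComp_integrable_ae (Lp.memLp F) (Lp.memLp G),
        kernelComp_integrable_ae (Lp.memLp F) (Lp.memLp G')] with z h1 h2
      simp only [kernelComp, Pi.add_apply, mul_add]
      exact integral_add h1 h2)
    (fun c F G => by
      rw [← MemLp.toLp_const_smul]
      refine MemLp.toLp_congr _ _ ((kernelComp_congr (Filter.EventuallyEq.refl _ _)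
        (Lp.coeFn_smul c G)).trans (Filter.Eventually.of_forall fun z => ?_))
      simp only [kernelComp, Pi.smul_apply, mul_smul_comm]
      exact integral_smul c _)).mkContinuous₂ 1 fun F G => by
    rw [one_mul, LinearMap.mk₂_apply, Lp.norm_toLp, Lp.norm_def, Lp.norm_def, ← ENNReal.toReal_mul]
    exact ENNReal.toReal_mono (ENNReal.mul_ne_top (Lp.eLpNorm_ne_top F) (Lp.eLpNorm_ne_top G))
      (eLpNorm_kernelComp_le (Lp.memLp F).1 (Lp.memLp G).1)

theorem coeFn_kernelCompL (F : Lp ℂ 2 (μ.prod ω)) (G : Lp ℂ 2 (ν.prod ω)) :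
    kernelCompL μ ν ω F G =ᵐ[μ.prod ν] kernelComp ω F G :=
  (memLp_kernelComp (Lp.memLp F) (Lp.memLp G)).coeFn_toLp

end Kernel

/-! ### Splitting coordinates -/

section Join

variable {ι κ τ ι' κ' τ' : Type*}

/-- Join two groups of coordinates along a bijection of the index sets. -/
def join (e : ι ⊕ κ ≃ τ) : (ι → ℝ) × (κ → ℝ) ≃ᵐ (τ → ℝ) :=
  (MeasurableEquiv.sumPiEquivProdPi fun _ => ℝ).symm.trans
    (MeasurableEquiv.piCongrLeft (fun _ => ℝ) e)

theorem join_apply (e : ι ⊕ κ ≃ τ) (z : (ι → ℝ) × (κ → ℝ)) (x : ι ⊕ κ) :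
    join e z (e x) = Sum.elim z.1 z.2 x := by
  simp only [join, MeasurableEquiv.trans_apply, MeasurableEquiv.coe_piCongrLeft,
    Equiv.piCongrLeft_apply_apply]
  cases x <;> rfl

/-- `Equiv.prodProdProdComm` as a measurable equivalence. -/
def prodComm4 (α β γ δ : Type*) [MeasurableSpace α] [MeasurableSpace β] [MeasurableSpace γ]
    [MeasurableSpace δ] : (α × β) × (γ × δ) ≃ᵐ (α × γ) × (β × δ) where
  toEquiv := Equiv.prodProdProdComm α β γ δ
  measurable_toFun := by
    change Measurable fun z : (α × β) × (γ × δ) => ((z.1.1, z.2.1), (z.1.2, z.2.2))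
    fun_prop
  measurable_invFun := by
    change Measurable fun z : (α × γ) × (β × δ) => ((z.1.1, z.2.1), (z.1.2, z.2.2))
    fun_prop

/-- `join` in both factors of a product, with the first groups of both factors collected in the
first argument and the second groups in the second argument. -/
def join₂ (e : ι ⊕ κ ≃ τ) (e' : ι' ⊕ κ' ≃ τ') :
    ((ι → ℝ) × (ι' → ℝ)) × ((κ → ℝ) × (κ' → ℝ)) ≃ᵐ (τ → ℝ) × (τ' → ℝ) :=
  (prodComm4 _ _ _ _).trans ((join e).prodCongr (join e'))

theorem join₂_apply (e : ι ⊕ κ ≃ τ) (e' : ι' ⊕ κ' ≃ τ') (a : (ι → ℝ) × (ι' → ℝ))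
    (b : (κ → ℝ) × (κ' → ℝ)) :
    join₂ e e' (a, b) = (join e (a.1, b.1), join e' (a.2, b.2)) := rfl

theorem measurePreserving_prodComm4 {α β γ δ : Type*} [MeasurableSpace α] [MeasurableSpace β]
    [MeasurableSpace γ] [MeasurableSpace δ] (μ : Measure α) (ν : Measure β) (ω : Measure γ)
    (ρ : Measure δ) [SigmaFinite μ] [SigmaFinite ν] [SigmaFinite ω] [SigmaFinite ρ] :
    MeasurePreserving (prodComm4 α β γ δ) ((μ.prod ν).prod (ω.prod ρ))
      ((μ.prod ω).prod (ν.prod ρ)) := by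
  have h1 := measurePreserving_prodAssoc μ ν (ω.prod ρ)
  have h2 := (MeasurePreserving.id μ).prod ((measurePreserving_prodAssoc ν ω ρ).symm)
  have h3 := (MeasurePreserving.id μ).prod
    ((Measure.measurePreserving_swap (μ := ν) (ν := ω)).prod (MeasurePreserving.id ρ))
  have h4 := (MeasurePreserving.id μ).prod (measurePreserving_prodAssoc ω ν ρ)
  have h5 := (measurePreserving_prodAssoc μ ω (ν.prod ρ)).symm
  exact h5.comp (h4.comp (h3.comp (h2.comp h1)))

variable [Fintype ι] [Fintype κ] [Fintype τ] [Fintype ι'] [Fintype κ'] [Fintype τ']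

/-- Lebesgue measure on the nonnegative orthant with coordinates indexed by a finite type. -/
abbrev orthant (ι : Type*) [Fintype ι] : Measure (ι → ℝ) :=
  Measure.pi fun _ => (volume : Measure ℝ).restrict (Set.Ici 0)

theorem measurePreserving_join (e : ι ⊕ κ ≃ τ) :
    MeasurePreserving (join e) ((orthant ι).prod (orthant κ)) (orthant τ) :=
  (measurePreserving_piCongrLeft (fun _ : τ => (volume : Measure ℝ).restrict (Set.Ici 0)) e).comp
    (measurePreserving_sumPiEquivProdPi_symm
      fun _ : ι ⊕ κ => (volume : Measure ℝ).restrict (Set.Ici 0))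

theorem measurePreserving_join₂ (e : ι ⊕ κ ≃ τ) (e' : ι' ⊕ κ' ≃ τ') :
    MeasurePreserving (join₂ e e')
      (((orthant ι).prod (orthant ι')).prod ((orthant κ).prod (orthant κ')))
      ((orthant τ).prod (orthant τ')) :=
  ((measurePreserving_join e).prod (measurePreserving_join e')).comp
    (measurePreserving_prodComm4 _ _ _ _)

end Join

/-! ### The indices of a bicontraction -/

section Index

/-- `Fin n` split into the first `n - p` indices (left) and the last `p` indices in reversed order
(right): the variables of a factor that is contracted at its end. -/
def endSplit {p n : ℕ} (h : p ≤ n) : Fin (n - p) ⊕ Fin p ≃ Fin n :=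
  (Equiv.sumCongr (Equiv.refl _) Fin.revPerm).trans
    (finSumFinEquiv.trans (finCongr (Nat.sub_add_cancel h)))

/-- `Fin n` split into the last `n - p` indices (left) and the first `p` indices (right): the
variables of a factor that is contracted at its start. -/
def startSplit {p n : ℕ} (h : p ≤ n) : Fin (n - p) ⊕ Fin p ≃ Fin n :=
  (Equiv.sumComm _ _).trans (finSumFinEquiv.trans (finCongr (Nat.add_sub_cancel' h)))

/-- `Fin (a + b)` split into its first `a` and its last `b` indices. -/
def appendIdx {a b N : ℕ} (h : a + b = N) : Fin a ⊕ Fin b ≃ Fin N :=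
  finSumFinEquiv.trans (finCongr h)

@[simp] theorem endSplit_inl {p n : ℕ} (h : p ≤ n) (i : Fin (n - p)) :
    (endSplit h (Sum.inl i) : ℕ) = i := by
  simp [endSplit]

@[simp] theorem endSplit_inr {p n : ℕ} (h : p ≤ n) (k : Fin p) :
    (endSplit h (Sum.inr k) : ℕ) = n - 1 - k := by
  simp [endSplit]
  omega

@[simp] theorem startSplit_inl {p n : ℕ} (h : p ≤ n) (i : Fin (n - p)) :
    (startSplit h (Sum.inl i) : ℕ) = p + i := by
  simp [startSplit]

@[simp] theorem startSplit_inr {p n : ℕ} (h : p ≤ n) (k : Fin p) :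
    (startSplit h (Sum.inr k) : ℕ) = k := by
  simp [startSplit]

@[simp] theorem appendIdx_inl {a b N : ℕ} (h : a + b = N) (i : Fin a) :
    (appendIdx h (Sum.inl i) : ℕ) = i := by
  simp [appendIdx]

@[simp] theorem appendIdx_inr {a b N : ℕ} (h : a + b = N) (i : Fin b) :
    (appendIdx h (Sum.inr i) : ℕ) = a + i := by
  simp [appendIdx]

variable {n₁ m₁ n₂ m₂ p r : ℕ}

theorem le_left (hp : p ≤ min n₁ n₂) : p ≤ n₁ := hp.trans (min_le_left _ _)
theorem le_right (hp : p ≤ min n₁ n₂) : p ≤ n₂ := hp.trans (min_le_right _ _)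

/-- The variables `t` of a bicontraction: first those left of `f`, then those left of `g`. -/
def outIdx₁ (hp : p ≤ min n₁ n₂) : Fin (n₁ - p) ⊕ Fin (n₂ - p) ≃ Fin (n₁ + n₂ - 2 * p) :=
  appendIdx (by omega)

/-- The variables `u` of a bicontraction. Those left of `f` form the left summand, although they
come after those left of `g`. -/
def outIdx₂ (hr : r ≤ min m₁ m₂) : Fin (m₁ - r) ⊕ Fin (m₂ - r) ≃ Fin (m₁ + m₂ - 2 * r) :=
  (Equiv.sumComm _ _).trans (appendIdx (by omega))

theorem argF₁_join (hp : p ≤ min n₁ n₂) (a : Fin (n₁ - p) → ℝ) (b : Fin (n₂ - p) → ℝ)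
    (s : Fin p → ℝ) :
    argF₁ hp (join (outIdx₁ hp) (a, b)) s = join (endSplit (le_left hp)) (a, s) := by
  funext i
  obtain ⟨x, rfl⟩ := (endSplit (le_left hp)).surjective i
  rw [join_apply]
  have hp1 := le_left hp
  rcases x with i | k
  · have h : ((endSplit (le_left hp)) (Sum.inl i) : ℕ) < n₁ - p := by simp
    rw [argF₁, dif_pos h, Sum.elim_inl]
    refine (congrArg (join (outIdx₁ hp) (a, b)) (Fin.ext ?_)).trans
      (join_apply (outIdx₁ hp) (a, b) (Sum.inl i))
    simp [outIdx₁]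
  · have h : ¬ ((endSplit (le_left hp)) (Sum.inr k) : ℕ) < n₁ - p := by simp; omega
    rw [argF₁, dif_neg h, Sum.elim_inr]
    congr 1
    ext
    simp
    omega

theorem argG₁_join (hp : p ≤ min n₁ n₂) (a : Fin (n₁ - p) → ℝ) (b : Fin (n₂ - p) → ℝ)
    (s : Fin p → ℝ) :
    argG₁ hp (join (outIdx₁ hp) (a, b)) s = join (startSplit (le_right hp)) (b, s) := by
  funext i
  obtain ⟨x, rfl⟩ := (startSplit (le_right hp)).surjective i
  rw [join_apply]
  have hp1 := le_left hp
  rcases x with i | k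
  · have h : ¬ ((startSplit (le_right hp)) (Sum.inl i) : ℕ) < p := by simp
    rw [argG₁, dif_neg h, Sum.elim_inl]
    refine (congrArg (join (outIdx₁ hp) (a, b)) (Fin.ext ?_)).trans
      (join_apply (outIdx₁ hp) (a, b) (Sum.inr i))
    simp [outIdx₁]
  · have h : ((startSplit (le_right hp)) (Sum.inr k) : ℕ) < p := by simp
    rw [argG₁, dif_pos h, Sum.elim_inr]
    simp

theorem argF₂_join (hr : r ≤ min m₁ m₂) (a : Fin (m₁ - r) → ℝ) (b : Fin (m₂ - r) → ℝ)
    (y : Fin r → ℝ) :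
    argF₂ hr (join (outIdx₂ hr) (a, b)) y = join (startSplit (le_left hr)) (a, y) := by
  funext i
  obtain ⟨x, rfl⟩ := (startSplit (le_left hr)).surjective i
  rw [join_apply]
  rcases x with i | k
  · have h : ¬ ((startSplit (le_left hr)) (Sum.inl i) : ℕ) < r := by simp
    rw [argF₂, dif_neg h, Sum.elim_inl]
    refine (congrArg (join (outIdx₂ hr) (a, b)) (Fin.ext ?_)).trans
      (join_apply (outIdx₂ hr) (a, b) (Sum.inl i))
    simp [outIdx₂]
  · have h : ((startSplit (le_left hr)) (Sum.inr k) : ℕ) < r := by simp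
    rw [argF₂, dif_pos h, Sum.elim_inr]
    simp

theorem argG₂_join (hr : r ≤ min m₁ m₂) (a : Fin (m₁ - r) → ℝ) (b : Fin (m₂ - r) → ℝ)
    (y : Fin r → ℝ) :
    argG₂ hr (join (outIdx₂ hr) (a, b)) y = join (endSplit (le_right hr)) (b, y) := by
  funext i
  obtain ⟨x, rfl⟩ := (endSplit (le_right hr)).surjective i
  rw [join_apply]
  have hr1 := le_right hr
  rcases x with i | k
  · have h : ((endSplit (le_right hr)) (Sum.inl i) : ℕ) < m₂ - r := by simp
    rw [argG₂, dif_pos h, Sum.elim_inl]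
    refine (congrArg (join (outIdx₂ hr) (a, b)) (Fin.ext ?_)).trans
      (join_apply (outIdx₂ hr) (a, b) (Sum.inr i))
    simp [outIdx₂]
  · have h : ¬ ((endSplit (le_right hr)) (Sum.inr k) : ℕ) < m₂ - r := by simp; omega
    rw [argG₂, dif_neg h, Sum.elim_inr]
    congr 1
    ext
    simp
    omega

end Index

/-! ### Bicontractions as compositions of kernels -/

section Bicontraction

variable {n₁ m₁ n₂ m₂ p r : ℕ}

/-- The variables of `f`, split into free and contracted ones. -/
abbrev coordF (hp : p ≤ min n₁ n₂) (hr : r ≤ min m₁ m₂) :=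
  join₂ (endSplit (le_left hp)) (startSplit (le_left hr))

/-- The variables of `g`, split into free and contracted ones. -/
abbrev coordG (hp : p ≤ min n₁ n₂) (hr : r ≤ min m₁ m₂) :=
  join₂ (startSplit (le_right hp)) (endSplit (le_right hr))

/-- The variables of the bicontraction, split into those of `f` and those of `g`. -/
abbrev coordOut (hp : p ≤ min n₁ n₂) (hr : r ≤ min m₁ m₂) :=
  join₂ (outIdx₁ hp) (outIdx₂ hr)

theorem bicontractionFun_coordOut (hp : p ≤ min n₁ n₂) (hr : r ≤ min m₁ m₂)
    (f : L2Tensor n₁ m₁) (g : L2Tensor n₂ m₂)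
    (z : ((Fin (n₁ - p) → ℝ) × (Fin (m₁ - r) → ℝ)) × ((Fin (n₂ - p) → ℝ) × (Fin (m₂ - r) → ℝ))) :
    bicontractionFun hp hr f g (coordOut hp hr z) =
      kernelComp ((leb p).prod (leb r)) (f ∘ coordF hp hr) (g ∘ coordG hp hr) z := by
  obtain ⟨a, b⟩ := z
  simp only [bicontractionFun, kernelComp, coordOut, coordF, coordG, join₂_apply, argF₁_join,
    argG₁_join, argF₂_join, argG₂_join, Function.comp_apply]

/-- The bicontraction as a continuous bilinear map: split the variables, compose the kernels, and
join the free variables. It agrees with `bicontraction` by `bicontraction_eq`. -/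
def bicontractionL (hp : p ≤ min n₁ n₂) (hr : r ≤ min m₁ m₂) :
    L2Tensor n₁ m₁ →L[ℂ] L2Tensor n₂ m₂ →L[ℂ]
      L2Tensor (n₁ + n₂ - 2 * p) (m₁ + m₂ - 2 * r) :=
  ((ContinuousLinearMap.compL ℂ _ _ _
    (Lp.compMeasurePreservingₗᵢ ℂ _
      (measurePreserving_join₂ (outIdx₁ hp) (outIdx₂ hr)).symm).toContinuousLinearMap).comp
    ((kernelCompL _ _ ((leb p).prod (leb r))).bilinearComp
      (Lp.compMeasurePreservingₗᵢ ℂ _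
        (measurePreserving_join₂ (endSplit (le_left hp)) (startSplit (le_left hr)))
          ).toContinuousLinearMap
      (Lp.compMeasurePreservingₗᵢ ℂ _
        (measurePreserving_join₂ (startSplit (le_right hp)) (endSplit (le_right hr)))
          ).toContinuousLinearMap))

theorem coeFn_bicontractionL (hp : p ≤ min n₁ n₂) (hr : r ≤ min m₁ m₂)
    {f : L2Tensor n₁ m₁} {g : L2Tensor n₂ m₂} {f₀ : (Fin n₁ → ℝ) × (Fin m₁ → ℝ) → ℂ}
    {g₀ : (Fin n₂ → ℝ) × (Fin m₂ → ℝ) → ℂ} (hf : f =ᵐ[(leb n₁).prod (leb m₁)] f₀)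
    (hg : g =ᵐ[(leb n₂).prod (leb m₂)] g₀) :
    bicontractionL hp hr f g =ᵐ[(leb (n₁ + n₂ - 2 * p)).prod (leb (m₁ + m₂ - 2 * r))]
      kernelComp ((leb p).prod (leb r)) (f₀ ∘ coordF hp hr) (g₀ ∘ coordG hp hr) ∘
        (coordOut hp hr).symm := by
  have mpF := measurePreserving_join₂ (endSplit (le_left hp)) (startSplit (le_left hr))
  have mpG := measurePreserving_join₂ (startSplit (le_right hp)) (endSplit (le_right hr))
  have mpO := (measurePreserving_join₂ (outIdx₁ hp) (outIdx₂ hr)).symm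
  have h1 : bicontractionL hp hr f g =
      Lp.compMeasurePreserving _ mpO (kernelCompL _ _ ((leb p).prod (leb r))
        (Lp.compMeasurePreserving _ mpF f) (Lp.compMeasurePreserving _ mpG g)) := rfl
  rw [h1]
  refine (Lp.coeFn_compMeasurePreserving _ mpO).trans ?_
  refine mpO.quasiMeasurePreserving.ae_eq_comp ((coeFn_kernelCompL _ _).trans ?_)
  exact kernelComp_congr
    ((Lp.coeFn_compMeasurePreserving f mpF).trans (mpF.quasiMeasurePreserving.ae_eq_comp hf))
    ((Lp.coeFn_compMeasurePreserving g mpG).trans (mpG.quasiMeasurePreserving.ae_eq_comp hg))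

theorem bicontraction_eq (hp : p ≤ min n₁ n₂) (hr : r ≤ min m₁ m₂)
    (f : L2Tensor n₁ m₁) (g : L2Tensor n₂ m₂) :
    bicontraction hp hr f g = bicontractionL hp hr f g := by
  have h : bicontractionL hp hr f g =ᵐ[(leb (n₁ + n₂ - 2 * p)).prod (leb (m₁ + m₂ - 2 * r))]
      bicontractionFun hp hr f g := by
    refine (coeFn_bicontractionL hp hr (Filter.EventuallyEq.refl _ _)
      (Filter.EventuallyEq.refl _ _)).trans (Filter.Eventually.of_forall fun z => ?_)
    simp only [Function.comp_apply]
    have := bicontractionFun_coordOut hp hr f g ((coordOut hp hr).symm z)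
    rw [MeasurableEquiv.apply_symm_apply] at this
    exact this.symm
  have hm : MemLp (bicontractionFun hp hr f g) 2
      ((leb (n₁ + n₂ - 2 * p)).prod (leb (m₁ + m₂ - 2 * r))) :=
    (memLp_congr_ae h).1 (Lp.memLp _)
  rw [bicontraction, dif_pos hm]
  exact Lp.ext (hm.coeFn_toLp.trans h.symm)

/-- Join two tuples along a bijection of the index sets. -/
def joinTuple {ι κ τ V : Type*} (e : ι ⊕ κ ≃ τ) (U : ι → V) (U' : κ → V) : τ → V :=
  fun i => Sum.elim U U' (e.symm i)

theorem rectFun_join {a b N : ℕ} (e : Fin a ⊕ Fin b ≃ Fin N) (R : Fin N → ℝ≥0 →₀ ℝ)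
    (x : (Fin a → ℝ) × (Fin b → ℝ)) :
    rectFun R (join e x) = rectFun (R ∘ e ∘ Sum.inl) x.1 * rectFun (R ∘ e ∘ Sum.inr) x.2 := by
  simp only [rectFun]
  rw [← Equiv.prod_comp e, Fintype.prod_sum_type]
  simp [join_apply]

theorem rectFun_joinTuple {a b N : ℕ} (e : Fin a ⊕ Fin b ≃ Fin N) (U : Fin a → ℝ≥0 →₀ ℝ)
    (U' : Fin b → ℝ≥0 →₀ ℝ) (x : (Fin a → ℝ) × (Fin b → ℝ)) :
    rectFun (joinTuple e U U') (join e x) = rectFun U x.1 * rectFun U' x.2 := by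
  rw [rectFun_join]
  congr 2 <;> ext i : 1 <;> simp [joinTuple]

theorem coeFn_tensor_rect {n m : ℕ} (R : Fin n → ℝ≥0 →₀ ℝ) (Q : Fin m → ℝ≥0 →₀ ℝ) :
    tensorL2 (rect R) (rect Q) =ᵐ[(leb n).prod (leb m)] fun z => rectFun R z.1 * rectFun Q z.2 := by
  filter_upwards [coeFn_tensorL2 (rect R) (rect Q),
    Measure.quasiMeasurePreserving_fst.ae_eq_comp (coeFn_rect R),
    Measure.quasiMeasurePreserving_snd.ae_eq_comp (coeFn_rect Q)] with z h1 h2 h3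
  simp only [Function.comp_apply] at h2 h3
  rw [h1, h2, h3]

/-- The bicontraction of rectangle functions pairs the contracted sides and keeps the others. -/
theorem bicontraction_tensor_rect (hp : p ≤ min n₁ n₂) (hr : r ≤ min m₁ m₂)
    (R : Fin n₁ → ℝ≥0 →₀ ℝ) (Q : Fin m₁ → ℝ≥0 →₀ ℝ) (R' : Fin n₂ → ℝ≥0 →₀ ℝ)
    (Q' : Fin m₂ → ℝ≥0 →₀ ℝ) :
    bicontractionL hp hr (tensorL2 (rect R) (rect Q)) (tensorL2 (rect R') (rect Q')) =
      (((∏ k, minForm (R (endSplit (le_left hp) (Sum.inr k)))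
          (R' (startSplit (le_right hp) (Sum.inr k))) : ℝ) : ℂ) *
        ((∏ k, minForm (Q' (endSplit (le_right hr) (Sum.inr k)))
          (Q (startSplit (le_left hr) (Sum.inr k))) : ℝ) : ℂ)) •
        tensorL2
          (rect (joinTuple (outIdx₁ hp) (R ∘ endSplit (le_left hp) ∘ Sum.inl)
            (R' ∘ startSplit (le_right hp) ∘ Sum.inl)))
          (rect (joinTuple (outIdx₂ hr) (Q ∘ startSplit (le_left hr) ∘ Sum.inl)
            (Q' ∘ endSplit (le_right hr) ∘ Sum.inl))) := by
  apply Lp.ext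
  refine (coeFn_bicontractionL hp hr (coeFn_tensor_rect R Q) (coeFn_tensor_rect R' Q')).trans
    (Filter.EventuallyEq.trans ?_ (Lp.coeFn_smul _ _).symm)
  filter_upwards [coeFn_tensor_rect
    (joinTuple (outIdx₁ hp) (R ∘ endSplit (le_left hp) ∘ Sum.inl)
            (R' ∘ startSplit (le_right hp) ∘ Sum.inl))
    (joinTuple (outIdx₂ hr) (Q ∘ startSplit (le_left hr) ∘ Sum.inl)
            (Q' ∘ endSplit (le_right hr) ∘ Sum.inl))] with z hz
  rw [Pi.smul_apply, hz]
  obtain ⟨⟨a, b⟩, rfl⟩ := (coordOut hp hr).surjective z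
  rw [Function.comp_apply, MeasurableEquiv.symm_apply_apply]
  simp only [Function.comp_apply, kernelComp, join₂_apply, rectFun_joinTuple]
  simp only [rectFun_join, smul_eq_mul]
  rw [← integral_rectFun_mul (fun k => R (endSplit (le_left hp) (Sum.inr k))),
    ← integral_rectFun_mul (fun k => Q' (endSplit (le_right hr) (Sum.inr k))),
    ← integral_prod_mul, ← integral_mul_const]
  refine integral_congr_ae (Filter.Eventually.of_forall fun w => ?_)
  simp only [Function.comp_def]
  ring

end Bicontraction

/-! ### The product formula -/

section Product

variable {A : Type u} [CStarAlgebra A]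

theorem wickTuple_joinTuple (S : ℝ≥0 → A) {a b N : ℕ} (h : a + b = N) (U : Fin a → ℝ≥0 →₀ ℝ)
    (U' : Fin b → ℝ≥0 →₀ ℝ) :
    wickTuple S (joinTuple (appendIdx h) U U') =
      wick minForm (brownianMap S) (List.ofFn U ++ List.ofFn U') := by
  subst h
  rw [wickTuple, ← List.ofFn_fin_append]
  congr 2
  ext i : 1
  refine Fin.addCases (fun i => ?_) (fun i => ?_) i <;> simp [joinTuple, appendIdx]

/-- The product formula for Wick words, with the contracted and the free letters picked out by the
index maps of the contractions. -/
theorem wickTuple_mul_aux (S : ℝ≥0 → A) {n₁ n₂ : ℕ} (R : Fin n₁ → ℝ≥0 →₀ ℝ)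
    (R' : Fin n₂ → ℝ≥0 →₀ ℝ) :
    wickTuple S R * wickTuple S R' = ∑ p : Fin (min n₁ n₂ + 1),
      (∏ k, minForm (R (endSplit (le_left (Nat.le_of_lt_succ p.isLt)) (Sum.inr k)))
          (R' (startSplit (le_right (Nat.le_of_lt_succ p.isLt)) (Sum.inr k)))) •
        wick minForm (brownianMap S)
          (List.ofFn (R ∘ endSplit (le_left (Nat.le_of_lt_succ p.isLt)) ∘ Sum.inl) ++
            List.ofFn (R' ∘ startSplit (le_right (Nat.le_of_lt_succ p.isLt)) ∘ Sum.inl)) := by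
  have h := wick_reverse_mul_wick (B := minForm) (X := brownianMap S) (List.ofFn R).reverse
    (List.ofFn R')
  rw [List.reverse_reverse, List.length_reverse, List.length_ofFn, List.length_ofFn,
    Finset.sum_range] at h
  rw [wickTuple, wickTuple, h]
  refine Finset.sum_congr rfl fun p _ => ?_
  have hp := Nat.le_of_lt_succ p.isLt
  have h1 := le_left hp
  have h2 := le_right hp
  congr 1
  · rw [← List.prod_ofFn]
    congr 1
    refine List.ext_getElem (by simp; omega) fun i hi hi' => ?_
    simp only [List.getElem_zipWith, List.getElem_take, List.getElem_reverse, List.getElem_ofFn,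
      List.length_ofFn]
    congr 3
    ext
    simp
  · congr 2
    · rw [List.drop_reverse, List.reverse_reverse]
      refine List.ext_getElem (by simp) fun i hi hi' => ?_
      simp only [List.getElem_take, List.getElem_ofFn, Function.comp_apply]
      congr 1
    · refine List.ext_getElem (by simp) fun i hi hi' => ?_
      simp only [List.getElem_drop, List.getElem_ofFn, Function.comp_apply]
      congr 1

/-- The product formula in the form needed in the left tensor factor. -/
theorem wickTuple_mul₁ (S : ℝ≥0 → A) {n₁ n₂ : ℕ} (R : Fin n₁ → ℝ≥0 →₀ ℝ)
    (R' : Fin n₂ → ℝ≥0 →₀ ℝ) :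
    wickTuple S R * wickTuple S R' = ∑ p : Fin (min n₁ n₂ + 1),
      (∏ k, minForm (R (endSplit (le_left (Nat.le_of_lt_succ p.isLt)) (Sum.inr k)))
          (R' (startSplit (le_right (Nat.le_of_lt_succ p.isLt)) (Sum.inr k)))) •
        wickTuple S (joinTuple (outIdx₁ (Nat.le_of_lt_succ p.isLt))
          (R ∘ endSplit (le_left (Nat.le_of_lt_succ p.isLt)) ∘ Sum.inl)
          (R' ∘ startSplit (le_right (Nat.le_of_lt_succ p.isLt)) ∘ Sum.inl)) := by
  rw [wickTuple_mul_aux]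
  refine Finset.sum_congr rfl fun p _ => ?_
  rw [outIdx₁, wickTuple_joinTuple]

theorem joinTuple_outIdx₂ {m₁ m₂ r : ℕ} {V : Type*} (hr : r ≤ min m₁ m₂) (U : Fin (m₁ - r) → V)
    (U' : Fin (m₂ - r) → V) (h : m₂ - r + (m₁ - r) = m₁ + m₂ - 2 * r) :
    joinTuple (outIdx₂ hr) U U' = joinTuple (appendIdx h) U' U := by
  ext i
  obtain ⟨x, rfl⟩ := (appendIdx h).surjective i
  cases x <;> simp [joinTuple, outIdx₂]

/-- The product formula in the form needed in the right tensor factor, where the order of the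
product is reversed. -/
theorem wickTuple_mul₂ (S : ℝ≥0 → A) {m₁ m₂ : ℕ} (Q : Fin m₁ → ℝ≥0 →₀ ℝ)
    (Q' : Fin m₂ → ℝ≥0 →₀ ℝ) :
    wickTuple S Q' * wickTuple S Q = ∑ r : Fin (min m₁ m₂ + 1),
      (∏ k, minForm (Q' (endSplit (le_right (Nat.le_of_lt_succ r.isLt)) (Sum.inr k)))
          (Q (startSplit (le_left (Nat.le_of_lt_succ r.isLt)) (Sum.inr k)))) •
        wickTuple S (joinTuple (outIdx₂ (Nat.le_of_lt_succ r.isLt))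
          (Q ∘ startSplit (le_left (Nat.le_of_lt_succ r.isLt)) ∘ Sum.inl)
          (Q' ∘ endSplit (le_right (Nat.le_of_lt_succ r.isLt)) ∘ Sum.inl)) := by
  rw [wickTuple_mul_aux]
  refine Fintype.sum_equiv (finCongr (by rw [min_comm])) _ _ fun r => ?_
  have hr : (r : ℕ) ≤ min m₁ m₂ := (Nat.le_of_lt_succ r.isLt).trans_eq (min_comm _ _)
  have h1 := le_left hr
  have h2 := le_right hr
  rw [joinTuple_outIdx₂ _ _ _ (by simp; omega), wickTuple_joinTuple]
  rfl

variable [PartialOrder A] [StarOrderedRing A]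

/-- `toBiL2` as a linear map. -/
def toBiL2ₗ (φ : A →ₚ[ℂ] ℂ) : A ⊗[ℂ] A →ₗ[ℂ] BiL2 φ :=
  (Completion.toComplL (𝕜 := ℂ) (E := φ.GNS ⊗[ℂ] φ.GNS)).toLinearMap ∘ₗ
    TensorProduct.map (toL2 φ) (toL2 φ)

theorem toBiL2ₗ_apply {φ : A →ₚ[ℂ] ℂ} (x : A ⊗[ℂ] A) : toBiL2ₗ φ x = toBiL2 φ x := rfl

/-- The right-hand side of the biproduct formula as a continuous bilinear map in `(f, g)`. -/
def biproduct (φ : A →ₚ[ℂ] ℂ) (S : ℝ≥0 → A) (n₁ m₁ n₂ m₂ : ℕ) :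
    L2Tensor n₁ m₁ →L[ℂ] L2Tensor n₂ m₂ →L[ℂ] BiL2 φ :=
  ∑ p : Fin (min n₁ n₂ + 1), ∑ r : Fin (min m₁ m₂ + 1),
    (ContinuousLinearMap.compL ℂ _ _ _ (biIntegral φ S (n₁ + n₂ - 2 * p) (m₁ + m₂ - 2 * r))).comp
      (bicontractionL (Nat.le_of_lt_succ p.isLt) (Nat.le_of_lt_succ r.isLt))

theorem biproduct_apply (φ : A →ₚ[ℂ] ℂ) (S : ℝ≥0 → A) {n₁ m₁ n₂ m₂ : ℕ} (f : L2Tensor n₁ m₁)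
    (g : L2Tensor n₂ m₂) :
    biproduct φ S n₁ m₁ n₂ m₂ f g = ∑ p : Fin (min n₁ n₂ + 1), ∑ r : Fin (min m₁ m₂ + 1),
      biIntegral φ S (n₁ + n₂ - 2 * p) (m₁ + m₂ - 2 * r)
        (bicontraction (Nat.le_of_lt_succ p.isLt) (Nat.le_of_lt_succ r.isLt) f g) := by
  simp only [biproduct, sum_apply, bicontraction_eq]
  rfl

variable [WStarAlgebra A] {φ : A →ₚ[ℂ] ℂ} {F : ℝ≥0 → StarSubalgebra ℂ A} {S : ℝ≥0 → A}

theorem biproduct_tensor_rect (hφ : IsTracialState φ) (hS : IsFreeBrownianMotion φ F S)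
    {n₁ m₁ n₂ m₂ : ℕ} (R : Fin n₁ → ℝ≥0 →₀ ℝ) (Q : Fin m₁ → ℝ≥0 →₀ ℝ) (R' : Fin n₂ → ℝ≥0 →₀ ℝ)
    (Q' : Fin m₂ → ℝ≥0 →₀ ℝ) :
    biproduct φ S n₁ m₁ n₂ m₂ (tensorL2 (rect R) (rect Q)) (tensorL2 (rect R') (rect Q')) =
      toBiL2 φ (sharp (wickTuple S R ⊗ₜ[ℂ] wickTuple S Q)
        (wickTuple S R' ⊗ₜ[ℂ] wickTuple S Q')) := by
  rw [sharp_tmul, wickTuple_mul₁, wickTuple_mul₂, TensorProduct.sum_tmul, ← toBiL2ₗ_apply, map_sum,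
    biproduct_apply]
  refine Finset.sum_congr rfl fun p _ => ?_
  rw [TensorProduct.tmul_sum, map_sum]
  refine Finset.sum_congr rfl fun r _ => ?_
  rw [bicontraction_eq, bicontraction_tensor_rect, map_smul, biIntegral_tensor_rect hφ hS,
    ← toBiL2ₗ_apply, ← map_smul, mul_smul, ← TensorProduct.tmul_smul, ← TensorProduct.smul_tmul',
    Complex.coe_smul, Complex.coe_smul]
  rfl

/-- The biproduct formula: it holds for tensors of rectangle functions by the product formula for
Wick words, and passes to the closure because both sides are continuous in `(f, g)`. -/
theorem isSharp_biproduct (hφ : IsTracialState φ) (hS : IsFreeBrownianMotion φ F S)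
    {n₁ m₁ n₂ m₂ : ℕ} (f : L2Tensor n₁ m₁) (g : L2Tensor n₂ m₂) :
    IsSharp φ (biIntegral φ S n₁ m₁ f) (biIntegral φ S n₂ m₂ g)
      (biproduct φ S n₁ m₁ n₂ m₂ f g) := by
  let Φ (n m : ℕ) := Finsupp.linearCombination ℂ
    fun z : (Fin n → ℝ≥0 →₀ ℝ) × (Fin m → ℝ≥0 →₀ ℝ) =>
      (wickTuple S z.1 ⊗ₜ[ℂ] wickTuple S z.2 : A ⊗[ℂ] A)
  let Ψ (n m : ℕ) := Finsupp.linearCombination ℂ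
    fun z : (Fin n → ℝ≥0 →₀ ℝ) × (Fin m → ℝ≥0 →₀ ℝ) => tensorL2 (rect z.1) (rect z.2)
  have hI : ∀ n m c, biIntegral φ S n m (Ψ n m c) = toBiL2 φ (Φ n m c) := by
    intro n m c
    have : (biIntegral φ S n m).toLinearMap ∘ₗ Ψ n m = toBiL2ₗ φ ∘ₗ Φ n m := by
      ext z
      simp [Φ, Ψ, biIntegral_tensor_rect hφ hS, toBiL2ₗ_apply]
    exact congrArg (fun L => L c) this
  have hP : ∀ c d, biproduct φ S n₁ m₁ n₂ m₂ (Ψ n₁ m₁ c) (Ψ n₂ m₂ d) =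
      toBiL2 φ (sharp (Φ n₁ m₁ c) (Φ n₂ m₂ d)) := by
    intro c d
    simp only [← toBiL2ₗ_apply]
    induction c using Finsupp.induction_linear with
    | zero => simp
    | add c c' h h' => simp only [map_add, add_apply, LinearMap.add_apply, h, h']
    | single z c =>
      induction d using Finsupp.induction_linear with
      | zero => simp
      | add d d' h h' => simp only [map_add, h, h']
      | single w d =>
        simp only [Φ, Ψ, Finsupp.linearCombination_single, map_smul, smul_apply,
          LinearMap.smul_apply, biproduct_tensor_rect hφ hS, toBiL2ₗ_apply]
  have hd : DenseRange (Prod.map (Ψ n₁ m₁) (Ψ n₂ m₂)) :=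
    (denseRange_tensor_rect n₁ m₁).prodMap (denseRange_tensor_rect n₂ m₂)
  refine isClosed_property (p := fun q : L2Tensor n₁ m₁ × L2Tensor n₂ m₂ =>
    IsSharp φ (biIntegral φ S n₁ m₁ q.1) (biIntegral φ S n₂ m₂ q.2)
      (biproduct φ S n₁ m₁ n₂ m₂ q.1 q.2)) hd ?_ ?_ (f, g)
  · refine isClosed_closure.preimage (f := fun q : L2Tensor n₁ m₁ × L2Tensor n₂ m₂ =>
      (biIntegral φ S n₁ m₁ q.1, biIntegral φ S n₂ m₂ q.2, biproduct φ S n₁ m₁ n₂ m₂ q.1 q.2)) ?_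
    fun_prop
  · rintro ⟨c, d⟩
    refine subset_closure ⟨(Φ n₁ m₁ c, Φ n₂ m₂ d), ?_⟩
    simp only [Prod.map_apply, hI, hP]

end Product

/-! ### Uniqueness of the product -/

section Uniqueness

variable {A : Type u} [CStarAlgebra A] [PartialOrder A] [StarOrderedRing A] {φ : A →ₚ[ℂ] ℂ}

theorem norm_toL2_star (htr : ∀ x y, φ (x * y) = φ (y * x)) (x : A) :
    ‖toL2 φ (star x)‖ = ‖toL2 φ x‖ := by
  rw [norm_eq_sqrt_re_inner (𝕜 := ℂ), norm_eq_sqrt_re_inner (𝕜 := ℂ), inner_toL2, inner_toL2,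
    star_star, htr]

theorem norm_toL2_mul_le_left (a x : A) : ‖toL2 φ (a * x)‖ ≤ ‖a‖ * ‖toL2 φ x‖ := by
  have h1 : ∀ y : A, ‖toL2 φ y‖ = ‖φ.toPreGNS y‖ := fun y => Completion.norm_coe _
  rw [h1, h1]
  refine ((φ.leftMulMapPreGNS a).le_opNorm (φ.toPreGNS x)).trans ?_
  gcongr
  exact LinearMap.mkContinuous_norm_le _ (norm_nonneg a) _

theorem norm_toL2_mul_le_right (htr : ∀ x y, φ (x * y) = φ (y * x)) (a x : A) :
    ‖toL2 φ (x * a)‖ ≤ ‖a‖ * ‖toL2 φ x‖ := by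
  rw [← norm_toL2_star htr, star_mul, ← norm_toL2_star htr x, ← norm_star a]
  exact norm_toL2_mul_le_left _ _

theorem denseRange_toL2 : DenseRange (toL2 φ) := by
  have : ⇑(toL2 φ) = ((↑) : φ.PreGNS → φ.GNS) ∘ φ.toPreGNS := rfl
  rw [this]
  exact Completion.denseRange_coe.comp φ.toPreGNS.surjective.denseRange
    (Completion.continuous_coe _)

/-- A linear map on the algebra that is bounded for the `L²` norm extends to `L²`. -/
theorem exists_extension (T : A →ₗ[ℂ] A) {C : ℝ} (hT : ∀ x, ‖toL2 φ (T x)‖ ≤ C * ‖toL2 φ x‖) :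
    ∃ L : φ.GNS →L[ℂ] φ.GNS, ∀ x, L (toL2 φ x) = toL2 φ (T x) :=
  ⟨(toL2 φ ∘ₗ T).extendOfNorm (toL2 φ), fun x =>
    LinearMap.extendOfNorm_eq denseRange_toL2 ⟨C, hT⟩ x⟩

theorem inner_toBiL2_tmul (a b c d : A) :
    inner ℂ (toBiL2 φ (a ⊗ₜ b)) (toBiL2 φ (c ⊗ₜ d)) = φ (star a * c) * φ (star b * d) := by
  simp [toBiL2, Completion.inner_coe, inner_toL2]

theorem norm_toBiL2_star (htr : ∀ x y, φ (x * y) = φ (y * x)) (x : A ⊗[ℂ] A) :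
    ‖toBiL2 φ (star x)‖ = ‖toBiL2 φ x‖ := by
  have key : ∀ x y : A ⊗[ℂ] A, inner ℂ (toBiL2ₗ φ (star x)) (toBiL2ₗ φ (star y)) =
      inner ℂ (toBiL2ₗ φ y) (toBiL2ₗ φ x) := by
    intro x y
    induction x with
    | zero => simp
    | add x x' h h' => simp only [star_add, map_add, inner_add_left, inner_add_right, h, h']
    | tmul a b =>
      induction y with
      | zero => simp
      | add y y' h h' => simp only [star_add, map_add, inner_add_left, inner_add_right, h, h']
      | tmul c d =>
        rw [TensorProduct.star_tmul, TensorProduct.star_tmul, toBiL2ₗ_apply, toBiL2ₗ_apply,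
          toBiL2ₗ_apply, toBiL2ₗ_apply, inner_toBiL2_tmul, inner_toBiL2_tmul, star_star, star_star,
          htr a, htr b]
  rw [norm_eq_sqrt_re_inner (𝕜 := ℂ), norm_eq_sqrt_re_inner (𝕜 := ℂ), ← toBiL2ₗ_apply, key]
  rfl

/-- Testing `x ♯ y` against a fixed `a ⊗ b` is a bounded bilinear form for the `L²` norms: by
traciality `⟪a ⊗ b, x ♯ y⟫ = ⟪x*, M y⟫` with `M (e ⊗ f) = e a* ⊗ b* f`. -/
theorem exists_norm_inner_sharp_le (htr : ∀ x y, φ (x * y) = φ (y * x)) (a b : A) :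
    ∃ C, ∀ x y : A ⊗[ℂ] A, ‖inner ℂ (toBiL2 φ (a ⊗ₜ b)) (toBiL2 φ (sharp x y))‖ ≤
      C * (‖toBiL2 φ x‖ * ‖toBiL2 φ y‖) := by
  obtain ⟨R, hR⟩ := exists_extension (φ := φ) (LinearMap.mulRight ℂ (star a))
    (norm_toL2_mul_le_right htr (star a))
  obtain ⟨L, hL⟩ := exists_extension (φ := φ) (LinearMap.mulLeft ℂ (star b))
    (norm_toL2_mul_le_left (star b))
  set M := TensorProduct.mapL R L with hM
  have key : ∀ x y : A ⊗[ℂ] A, inner ℂ (toBiL2ₗ φ (a ⊗ₜ b)) (toBiL2ₗ φ (sharp x y)) =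
      inner ℂ (toBiL2ₗ φ (star x))
        ((M (TensorProduct.map (toL2 φ) (toL2 φ) y) : φ.GNS ⊗[ℂ] φ.GNS) : BiL2 φ) := by
    intro x y
    induction x with
    | zero => simp
    | add x x' h h' =>
      simp only [star_add, map_add, inner_add_left, inner_add_right, LinearMap.add_apply, h, h']
    | tmul c d =>
      induction y with
      | zero => simp only [map_zero, Completion.coe_zero, inner_zero_right]
      | add y y' h h' =>
        simp only [map_add, inner_add_right, h, h', Completion.coe_add]
      | tmul e f =>
        have : M (TensorProduct.map (toL2 φ) (toL2 φ) (e ⊗ₜ f)) =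
            TensorProduct.map (toL2 φ) (toL2 φ) ((e * star a) ⊗ₜ (star b * f)) := by
          simp [hM, hR, hL]
        rw [this, sharp_tmul, TensorProduct.star_tmul]
        change inner ℂ (toBiL2 φ _) (toBiL2 φ _) = inner ℂ (toBiL2 φ _) (toBiL2 φ _)
        rw [inner_toBiL2_tmul, inner_toBiL2_tmul, star_star, star_star, htr (star a),
          ← mul_assoc (star b), htr _ d, mul_assoc c]
  refine ⟨‖M‖, fun x y => ?_⟩
  have h1 := key x y
  rw [toBiL2ₗ_apply, toBiL2ₗ_apply, toBiL2ₗ_apply] at h1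
  rw [h1]
  refine (norm_inner_le_norm _ _).trans ?_
  rw [norm_toBiL2_star htr, Completion.norm_coe, mul_left_comm]
  gcongr
  refine (M.le_opNorm _).trans_eq ?_
  rw [toBiL2, Completion.norm_coe]

theorem eq_zero_of_inner_toBiL2 {U : BiL2 φ} (h : ∀ a b, inner ℂ (toBiL2 φ (a ⊗ₜ b)) U = 0) :
    U = 0 := by
  have h1 : ∀ g k : φ.GNS, inner ℂ ((g ⊗ₜ[ℂ] k : φ.GNS ⊗[ℂ] φ.GNS) : BiL2 φ) U = 0 := by
    intro g k
    refine isClosed_property2 (e := toL2 φ) denseRange_toL2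
      (p := fun g k => inner ℂ ((g ⊗ₜ[ℂ] k : φ.GNS ⊗[ℂ] φ.GNS) : BiL2 φ) U = 0)
      (isClosed_eq ?_ continuous_const) (fun a b => h a b) g k
    exact ((Completion.continuous_coe _).comp (by fun_prop)).inner continuous_const
  have h2 : ∀ t : φ.GNS ⊗[ℂ] φ.GNS, inner ℂ (t : BiL2 φ) U = 0 := by
    intro t
    induction t with
    | zero => rw [Completion.coe_zero, inner_zero_left]
    | add t t' h h' => rw [Completion.coe_add, inner_add_left, h, h', add_zero]
    | tmul g k => exact h1 g k
  have h3 : ∀ V : BiL2 φ, inner ℂ V U = 0 := fun V =>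
    Completion.induction_on V
      (isClosed_eq (continuous_id.inner continuous_const) continuous_const) h2
  exact inner_self_eq_zero.1 (h3 U)

theorem IsSharp.unique (htr : ∀ x y, φ (x * y) = φ (y * x)) {U V W W' : BiL2 φ}
    (h : IsSharp φ U V W) (h' : IsSharp φ U V W') : W = W' := by
  obtain ⟨z, hz, hzl⟩ := mem_closure_iff_seq_limit.1 h
  obtain ⟨z', hz', hzl'⟩ := mem_closure_iff_seq_limit.1 h'
  choose q hq using hz
  choose q' hq' using hz'
  obtain rfl : z = _ := (funext hq).symm
  obtain rfl : z' = _ := (funext hq').symm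
  simp only [Prod.tendsto_iff] at hzl hzl'
  obtain ⟨hU, hV, hW⟩ := hzl
  obtain ⟨hU', hV', hW'⟩ := hzl'
  rw [← sub_eq_zero]
  refine eq_zero_of_inner_toBiL2 fun a b => ?_
  obtain ⟨C, hC⟩ := exists_norm_inner_sharp_le htr a b
  have hlim := (tendsto_const_nhds (x := toBiL2 φ (a ⊗ₜ b))).inner (𝕜 := ℂ) (hW.sub hW')
  refine tendsto_nhds_unique hlim ?_
  have hbound : ∀ k, ‖inner ℂ (toBiL2 φ (a ⊗ₜ b))
      (toBiL2 φ (sharp (q k).1 (q k).2) - toBiL2 φ (sharp (q' k).1 (q' k).2))‖ ≤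
      C * (‖toBiL2 φ (q k).1 - toBiL2 φ (q' k).1‖ * ‖toBiL2 φ (q k).2‖) +
      C * (‖toBiL2 φ (q' k).1‖ * ‖toBiL2 φ (q k).2 - toBiL2 φ (q' k).2‖) := by
    intro k
    have h1 : toBiL2 φ (sharp (q k).1 (q k).2) - toBiL2 φ (sharp (q' k).1 (q' k).2) =
        toBiL2 φ (sharp ((q k).1 - (q' k).1) (q k).2) +
          toBiL2 φ (sharp (q' k).1 ((q k).2 - (q' k).2)) := by
      simp only [← toBiL2ₗ_apply, map_sub, LinearMap.sub_apply]
      abel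
    have h2 : ∀ x y : A ⊗[ℂ] A, toBiL2 φ x - toBiL2 φ y = toBiL2 φ (x - y) := fun x y =>
      (map_sub (toBiL2ₗ φ) x y).symm
    rw [h1, inner_add_right, h2 (q k).1, h2 (q k).2]
    exact (norm_add_le _ _).trans (add_le_add (hC _ _) (hC _ _))
  refine squeeze_zero_norm hbound ?_
  have h1 := (((hU.sub hU').norm.mul hV.norm).const_mul C).add
    ((hU'.norm.mul (hV.sub hV').norm).const_mul C)
  simpa using h1

end Uniqueness

end WignerSpace

end

theorem theorem3p3 {A : Type*} [CStarAlgebra A] [WStarAlgebra A] [PartialOrder A]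
    [StarOrderedRing A] (φ : A →ₚ[ℂ] ℂ) (hφ : WignerSpace.IsTracialState φ)
    (F : ℝ≥0 → StarSubalgebra ℂ A) (S : ℝ≥0 → A) (hS : WignerSpace.IsFreeBrownianMotion φ F S)
    (n₁ m₁ n₂ m₂ : ℕ) (f : WignerSpace.L2Tensor n₁ m₁) (g : WignerSpace.L2Tensor n₂ m₂)
    (W : WignerSpace.BiL2 φ) :
    WignerSpace.IsSharp φ (WignerSpace.biIntegral φ S n₁ m₁ f) (WignerSpace.biIntegral φ S n₂ m₂ g)
      W ↔
    W = ∑ p : Fin (min n₁ n₂ + 1), ∑ r : Fin (min m₁ m₂ + 1),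
      WignerSpace.biIntegral φ S (n₁ + n₂ - 2 * p) (m₁ + m₂ - 2 * r)
        (WignerSpace.bicontraction (Nat.le_of_lt_succ p.isLt) (Nat.le_of_lt_succ r.isLt) f g) := by
  have h := WignerSpace.isSharp_biproduct hφ hS f g
  rw [← WignerSpace.biproduct_apply]
  exact ⟨fun hW => hW.unique hφ.tracial h, fun hW => hW ▸ h⟩
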